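/- The following is a theorem of $\mathsf{ZF}$ (the Axiom of Choice is not assumed); that is, it holds in every model of $\mathsf{ZF}$. Conventions. $V_\alpha=\bigcup_{\beta<\alpha}\mathcal P(V_\beta)$ is the cumulative hierarchy. For sets $X\subseteq A$, $X\prec A$ means that $(X,\in)$ is an elementary submodel of $(A,\in)$. For a set $x$, $\|x\|$ is the least ordinal $\alpha$ such that there is a surjection from $V_\alpha$ onto $x$. Cardinals are initial ordinals; an infinite cardinal $\kappa$ is singular if $\mathrm{cf}(\kappa)<\kappa$, and $\kappa^+$ is the least cardinal greater than $\kappa$. An uncountable cardinal $\kappa$ is weakly Löwenheim–Skolem (weakly LS) if for every $\gamma<\kappa$, every ordinal $\alpha\ge\kappa$ and every $x\in V_\alpha$ there is $X\prec V_\alpha$ such that $V_\gamma\subseteq X$, $x\in X$, and the transitive collapse of $X$ belongs to $V_\kappa$. Lemma. Let $\kappa$ be a singular weakly LS cardinal. Then for every ordinal $\alpha\ge\kappa^+$ and every $x\in V_\alpha$ there is $X\prec V_\alpha$ such that $x\in X$, $V_\kappa\subseteq X$, $X\cap\kappa^+\in\kappa^+$ (that is, $X\cap\kappa^+$ is an ordinal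 below $\kappa^+$), and $\|X\|=\kappa$ (in particular, there is a surjection from $V_\kappa$ onto $X$). -/

import Mathlib

universe u

/-- Relation symbols of the language of set theory: one binary symbol. -/
inductive SetTheoryRel : ℕ → Type
  | mem : SetTheoryRel 2

/-- The first-order language of set theory. -/
def setLang : FirstOrder.Language := ⟨fun _ => Empty, SetTheoryRel⟩

namespace ZFModel

variable {M : Type u} [setLang.Structure M]

/-- The membership relation of the structure `M`. -/
def Mem (x y : M) : Prop :=
  FirstOrder.Language.Structure.RelMap (L := setLang) (M := M) (n := 2) SetTheoryRel.mem ![x, y]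

infix:50 " ∈ₛ " => Mem

/-- `x ⊆ y` in `M`. -/
def Sub (x y : M) : Prop := ∀ z, z ∈ₛ x → z ∈ₛ y

infix:50 " ⊆ₛ " => Sub

/-- `x = ∅`. -/
def IsEmp (x : M) : Prop := ∀ z, ¬ z ∈ₛ x

/-- `s = x ∪ {x}`. -/
def IsSucc (s x : M) : Prop := ∀ z, z ∈ₛ s ↔ z ∈ₛ x ∨ z = x

/-- `w` contains `∅` and is closed under `x ↦ x ∪ {x}`. -/
def IsInductive (w : M) : Prop :=
  (∃ e, IsEmp e ∧ e ∈ₛ w) ∧ ∀ x, x ∈ₛ w → ∃ s, IsSucc s x ∧ s ∈ₛ w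

variable (M) in
/-- `M` is a model of `ZF` (without Choice). The instances of the separation and replacement
schemes, for formulas with parameters from `M`, are given through the classes and the binary
class relations that are first-order definable over `M` with parameters. -/
structure IsModelOfZF : Prop where
  extensionality : ∀ x y : M, (∀ z, z ∈ₛ x ↔ z ∈ₛ y) → x = y
  foundation : ∀ x : M, (∃ y, y ∈ₛ x) → ∃ y, y ∈ₛ x ∧ ∀ z, z ∈ₛ x → ¬ z ∈ₛ y
  pairing : ∀ x y : M, ∃ p, ∀ z, z ∈ₛ p ↔ z = x ∨ z = y
  union : ∀ x : M, ∃ v, ∀ z, z ∈ₛ v ↔ ∃ y, y ∈ₛ x ∧ z ∈ₛ y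
  powerset : ∀ x : M, ∃ p, ∀ z, z ∈ₛ p ↔ z ⊆ₛ x
  infinity : ∃ w : M, IsInductive w
  separation : ∀ D : Set M, (Set.univ : Set M).Definable₁ setLang D →
    ∀ a : M, ∃ b, ∀ z, z ∈ₛ b ↔ z ∈ₛ a ∧ z ∈ D
  replacement : ∀ F : Set (M × M), (Set.univ : Set M).Definable₂ setLang F →
    ∀ a : M, (∀ x, x ∈ₛ a → ∃! y, (x, y) ∈ F) →
      ∃ b, ∀ y, y ∈ₛ b ↔ ∃ x, x ∈ₛ a ∧ (x, y) ∈ F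

/-! ### Pairs and functions of `M` -/

/-- `p = {x, y}`. -/
def IsUPair (p x y : M) : Prop := ∀ z, z ∈ₛ p ↔ z = x ∨ z = y

/-- `p = ⟨x, y⟩ = {{x}, {x, y}}`. -/
def IsPair (p x y : M) : Prop := ∀ z, z ∈ₛ p ↔ IsUPair z x x ∨ IsUPair z x y

/-- `⟨x, y⟩ ∈ f`; for a function `f` this says `f(x) = y`. -/
def App (f x y : M) : Prop := ∃ p, IsPair p x y ∧ p ∈ₛ f

/-- `f : a → b` is a function. -/
def IsFun (f a b : M) : Prop :=
  (∀ p, p ∈ₛ f → ∃ x y, x ∈ₛ a ∧ y ∈ₛ b ∧ IsPair p x y) ∧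
    ∀ x, x ∈ₛ a → ∃! y, App f x y

/-- `f : a → b` is a surjection. -/
def IsSurj (f a b : M) : Prop :=
  IsFun f a b ∧ ∀ y, y ∈ₛ b → ∃ x, x ∈ₛ a ∧ App f x y

/-- `f : a → b` is a bijection. -/
def IsBij (f a b : M) : Prop :=
  IsSurj f a b ∧ ∀ x x' y, App f x y → App f x' y → x = x'

/-! ### Ordinals and cardinals of `M` -/

/-- `x` is a transitive set. -/
def IsTrans (x : M) : Prop := ∀ y, y ∈ₛ x → y ⊆ₛ x

/-- `x` is an ordinal: a transitive set of transitive sets. -/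
def IsOrd (x : M) : Prop := IsTrans x ∧ ∀ y, y ∈ₛ x → IsTrans y

/-- `w = ω`, the least inductive set. -/
def IsOmega (w : M) : Prop := IsInductive w ∧ ∀ v, IsInductive v → w ⊆ₛ v

/-- `k` is a cardinal: an ordinal not in bijection with any smaller ordinal. -/
def IsCard (k : M) : Prop := IsOrd k ∧ ∀ g, g ∈ₛ k → ¬ ∃ f, IsBij f g k

/-- `k` is an uncountable (well-ordered) cardinal. -/
def IsUncountableCard (k : M) : Prop := IsCard k ∧ ∃ w, IsOmega w ∧ w ∈ₛ k

/-- `k' = k⁺`, the least cardinal greater than `k`. -/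
def IsSuccCard (k' k : M) : Prop :=
  IsCard k' ∧ k ∈ₛ k' ∧ ∀ m, IsCard m → k ∈ₛ m → k' ⊆ₛ m

/-- `f : g → k` is a function whose range is cofinal in the ordinal `k`. -/
def IsCofinalMap (f g k : M) : Prop :=
  IsFun f g k ∧ ∀ b, b ∈ₛ k → ∃ x c, x ∈ₛ g ∧ App f x c ∧ b ⊆ₛ c

/-- `c = cf(k)`, the least ordinal with a cofinal map into `k`. -/
def IsCof (c k : M) : Prop :=
  IsOrd c ∧ (∃ f, IsCofinalMap f c k) ∧
    ∀ d, IsOrd d → (∃ f, IsCofinalMap f d k) → c ⊆ₛ d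

/-- `cf(k) < k`. For an infinite cardinal `k` this says that `k` is singular. -/
def IsSingular (k : M) : Prop := ∃ c, IsCof c k ∧ c ∈ₛ k

/-! ### The cumulative hierarchy of `M` -/

/-- `h` is a function with domain `a` and `h(b) = ⋃_{c < b} 𝒫(h(c))` for all `b ∈ a`. -/
def IsVSeq (h a : M) : Prop :=
  (∃ r, IsFun h a r) ∧
    ∀ b v, b ∈ₛ a → App h b v →
      ∀ z, z ∈ₛ v ↔ ∃ c t, c ∈ₛ b ∧ App h c t ∧ z ⊆ₛ t

/-- `v = V_a = ⋃_{b < a} 𝒫(V_b)`, for an ordinal `a`. -/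
def IsV (v a : M) : Prop :=
  IsOrd a ∧ ∃ h, IsVSeq h a ∧ ∀ z, z ∈ₛ v ↔ ∃ b t, b ∈ₛ a ∧ App h b t ∧ z ⊆ₛ t

/-- `n = ‖x‖`, the least ordinal `n` such that there is a surjection from `V_n` onto `x`. -/
def IsNorm (n x : M) : Prop :=
  (∃ v f, IsV v n ∧ IsSurj f v x) ∧ ∀ m, m ∈ₛ n → ¬ ∃ v f, IsV v m ∧ IsSurj f v x

/-- `c` is the transitive collapse of `(X, ∈)`: the range of the function `p` on `X` with
`p(x) = {p(y) | y ∈ x ∩ X}`. -/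
def IsCollapse (c X : M) : Prop :=
  ∃ p, IsSurj p X c ∧
    ∀ x v, x ∈ₛ X → App p x v →
      ∀ z, z ∈ₛ v ↔ ∃ y, y ∈ₛ X ∧ y ∈ₛ x ∧ App p y z

/-! ### Formulas and satisfaction inside `M`

Formulas of the language of set theory are coded by the following sets of `M`, where `i, j ∈ ω`:
`⟨0, ⟨i, j⟩⟩` is `vᵢ = vⱼ`, `⟨1, ⟨i, j⟩⟩` is `vᵢ ∈ vⱼ`, `⟨2, a⟩` is `¬ a`,
`⟨3, ⟨a, b⟩⟩` is `a ∧ b`, and `⟨4, ⟨i, a⟩⟩` is `∃ vᵢ a`. -/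

/-- `x` is the numeral `n` of `M`. -/
def IsNumeral : ℕ → M → Prop
  | 0, x => IsEmp x
  | n + 1, x => ∃ y, IsNumeral n y ∧ IsSucc x y

/-- `c = ⟨n, a⟩`. -/
def IsTag (n : ℕ) (c a : M) : Prop := ∃ t, IsNumeral n t ∧ IsPair c t a

/-- `c = ⟨n, ⟨a, b⟩⟩`. -/
def IsTag₂ (n : ℕ) (c a b : M) : Prop := ∃ p, IsPair p a b ∧ IsTag n c p

/-- `S` contains the atomic formulas and is closed under `¬`, `∧` and `∃ vᵢ`. -/
def FormClosed (S : M) : Prop :=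
  ∀ w, IsOmega w →
    (∀ i j c, i ∈ₛ w → j ∈ₛ w → IsTag₂ 0 c i j → c ∈ₛ S) ∧
    (∀ i j c, i ∈ₛ w → j ∈ₛ w → IsTag₂ 1 c i j → c ∈ₛ S) ∧
    (∀ a c, a ∈ₛ S → IsTag 2 c a → c ∈ₛ S) ∧
    (∀ a b c, a ∈ₛ S → b ∈ₛ S → IsTag₂ 3 c a b → c ∈ₛ S) ∧
    (∀ i a c, i ∈ₛ w → a ∈ₛ S → IsTag₂ 4 c i a → c ∈ₛ S)

/-- `a` is (the code of) a formula: it lies in every set closed under formula formation. -/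
def IsForm (a : M) : Prop := ∀ S, FormClosed S → a ∈ₛ S

/-- `s : ω → A`, an assignment of elements of `A` to the variables. -/
def IsAssign (s A : M) : Prop := ∃ w, IsOmega w ∧ IsFun s w A

/-- The assignments `s` and `s'` agree except possibly at the variable `i`. -/
def AgreeOff (i s s' : M) : Prop := ∀ j, j ≠ i → ∀ x, App s j x ↔ App s' j x

/-- `T` obeys Tarski's clauses for satisfaction in `(A, ∈)`, for all formulas and all
assignments; `⟨a, s⟩ ∈ T` is read as `(A, ∈) ⊨ a[s]`. -/
def IsSatRel (T A : M) : Prop :=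
  ∀ w s, IsOmega w → IsAssign s A →
    (∀ i j c, i ∈ₛ w → j ∈ₛ w → IsTag₂ 0 c i j →
      (App T c s ↔ ∃ x, App s i x ∧ App s j x)) ∧
    (∀ i j c, i ∈ₛ w → j ∈ₛ w → IsTag₂ 1 c i j →
      (App T c s ↔ ∃ x y, App s i x ∧ App s j y ∧ x ∈ₛ y)) ∧
    (∀ a c, IsForm a → IsTag 2 c a → (App T c s ↔ ¬ App T a s)) ∧
    (∀ a b c, IsForm a → IsForm b → IsTag₂ 3 c a b →
      (App T c s ↔ App T a s ∧ App T b s)) ∧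
    (∀ i a c, i ∈ₛ w → IsForm a → IsTag₂ 4 c i a →
      (App T c s ↔ ∃ s', IsAssign s' A ∧ AgreeOff i s s' ∧ App T a s'))

/-- `(A, ∈) ⊨ a[s]`. -/
def Sat (A a s : M) : Prop := ∃ T, IsSatRel T A ∧ App T a s

/-- `X ≺ A`: `(X, ∈)` is an elementary submodel of `(A, ∈)`. -/
def IsElemSub (X A : M) : Prop :=
  (∃ x, x ∈ₛ X) ∧ X ⊆ₛ A ∧
    ∀ a s, IsForm a → IsAssign s X → (Sat X a s ↔ Sat A a s)

/-! ### Weakly Löwenheim–Skolem cardinals of `M` -/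

/-- `k` is a weakly Löwenheim–Skolem cardinal: an uncountable cardinal such that for all
`g < k`, `a ≥ k` and `x ∈ V_a` there is `X ≺ V_a` with `V_g ⊆ X`, `x ∈ X` and the transitive
collapse of `X` in `V_k`. -/
def IsWeaklyLS (k : M) : Prop :=
  IsUncountableCard k ∧
    ∀ g a Vg Va Vk x, g ∈ₛ k → IsOrd a → k ⊆ₛ a → IsV Vg g → IsV Va a → IsV Vk k → x ∈ₛ Va →
      ∃ X, IsElemSub X Va ∧ Vg ⊆ₛ X ∧ x ∈ₛ X ∧ ∃ c, IsCollapse c X ∧ c ∈ₛ Vk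

end ZFModel

open ZFModel

/-!
The submodel is obtained without any choice as a union of a definable family of small sets that
come with enumerations.

Call a set `Z` of `M` a *hull* (`IsHull`) if it is closed under pairing and unpairing and if, for
every relation `q ∈ Z`, each `u ∈ Z` that has a `q`-successor has one in `Z`. Elementary submodels
of limit levels `V_b` are hulls (`IsElemSub.isHull`), so a weakly Löwenheim–Skolem cardinal `κ`
provides, for `g < κ` and any set `x`, a hull `Z ∋ x` with `V_g ⊆ Z` that is the image of some `V_d`,
`d < κ`, and does not include `κ` (`IsWeaklyLS.exists_isHull`): invert the transitive collapse, which
lies in `V_κ`. In particular no such `V_d` maps onto `κ`, and `κ` is a limit ordinal.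

If `κ` is singular, there is even a hull `W ∋ x` that includes `V_κ` and is an image of it
(`IsWeaklyLS.exists_isHull_V`). For this, fix a limit level `V_b ∋ x` and consider the functions from
some `V_d`, `d < κ`, to `V_b`. Given two of them and `d < κ`, the previous paragraph yields a third one
whose range includes both ranges and `V_d` and closes them off under one step of the hull operations.
This is a relation between sets; take a small hull `Y` that contains it, together with a cofinal map
`cf(κ) → κ`, and includes `V_{cf(κ)}`. The union `W` of the ranges of the functions that lie in `Y` is
a hull, it includes `V_κ` because `Y ∩ κ` is cofinal in `κ`, and `(y, z) ↦ h_y(z)`, where `y ↦ h_y`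
enumerates `Y`, maps a subset of `V_κ` onto it.

Now let `W` contain `x`, the relation "`y` witnesses `∃ vᵢ a` in `V_α` under the assignment `t`", the
function updating assignments, and the relation between the `ξ < κ⁺` and the surjections `κ → ξ`. As
formulas have finitely many free variables and hulls contain the needed finite modifications of a
constant assignment, the Tarski–Vaught criterion gives `X = W ∩ V_α ≺ V_α` (`IsHull.isElemSub`).
`X ∩ κ⁺` is transitive, hence an ordinal. It is not `κ⁺`, as `V_κ` does not map onto `κ⁺`
(`not_isSurj_of_card`): enumerate `κ⁺` by listing the image of each `V_d`, `d < κ`, before the rest; if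
the enumeration lasted beyond stage `κ`, some `V_d` with `d < κ` would map onto `κ`, and otherwise `κ⁺`
would be in bijection with an ordinal `≤ κ`. Finally `‖X‖ ≥ κ` by Cantor's argument.

All of this takes place inside `M`, which need not be well-founded. Instances of separation,
replacement and induction require definability of the predicates involved, which is left to
instance resolution (`DefP`, `DefF`). Satisfaction in the sense of `M` is constructed from an
inductively defined set of pairs (`satGraph`, `exists_tarski`).
-/

/-! ### Definable predicates and functions -/

namespace ZFModel

variable {M : Type u} [setLang.Structure M]

/-- The predicate `P` on `n`-tuples of elements of `M` is first-order definable over `M` with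
parameters. It is a class, so that definability of a concrete predicate is found by instance
resolution. -/
class DefP {n : ℕ} (P : (Fin n → M) → Prop) : Prop where
  out : (Set.univ : Set M).Definable setLang {v | P v}

/-- The graph of the function `f` of `n` arguments is first-order definable over `M` with
parameters. -/
class DefF {n : ℕ} (f : (Fin n → M) → M) : Prop where
  out : (Set.univ : Set M).DefinableFun setLang f

/-- `P` is a definable class. -/
abbrev Def₁ (P : M → Prop) : Prop := DefP (n := 1) fun v => P (v 0)

/-- `P` is a definable binary relation. -/
abbrev Def₂ (P : M → M → Prop) : Prop := DefP (n := 2) fun v => P (v 0) (v 1)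

/-- `F` is a definable class function. -/
abbrev DefF₁ (F : M → M) : Prop := DefF (n := 1) fun v => F (v 0)

theorem DefP.comp {m n : ℕ} {P : (Fin m → M) → Prop} (hP : DefP P) (F : Fin m → (Fin n → M) → M)
    (hF : ∀ i, DefF (F i)) : DefP fun v => P fun i => F i v :=
  ⟨Set.Definable.preimage_map (F := fun v i => F i v) (fun i => (hF i).out) hP.out⟩

theorem DefP.congr {n : ℕ} {P Q : (Fin n → M) → Prop} (hP : DefP P) (h : ∀ v, Q v ↔ P v) :
    DefP Q := by
  have : Q = P := funext fun v => propext (h v)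
  exact this ▸ hP

section Instances

variable {m n : ℕ} {P Q : (Fin n → M) → Prop} {f g : (Fin n → M) → M}

instance (p : Prop) : DefP (n := n) fun _ : Fin n → M => p := by
  constructor
  by_cases h : p
  · convert! (Set.definable_univ : (Set.univ : Set M).Definable setLang (Set.univ : Set (Fin n → M)))
    ext; simp [h]
  · convert! (Set.definable_empty : (Set.univ : Set M).Definable setLang (∅ : Set (Fin n → M)))
    ext; simp [h]

instance [hP : DefP P] : DefP fun v => ¬ P v := ⟨hP.out.compl⟩

instance [hP : DefP P] [hQ : DefP Q] : DefP fun v => P v ∧ Q v := ⟨hP.out.inter hQ.out⟩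

instance [hP : DefP P] [hQ : DefP Q] : DefP fun v => P v ∨ Q v := ⟨hP.out.union hQ.out⟩

instance [hP : DefP P] [hQ : DefP Q] : DefP fun v => P v → Q v :=
  DefP.congr (P := fun v => ¬ P v ∨ Q v) inferInstance fun _ => imp_iff_not_or

instance [hP : DefP P] [hQ : DefP Q] : DefP fun v => P v ↔ Q v :=
  DefP.congr (P := fun v => (P v → Q v) ∧ (Q v → P v)) inferInstance fun _ => iff_iff_implies_and_implies

instance {P : (Fin n → M) → M → Prop} [hP : DefP fun w : Fin (n + 1) → M =>
    P (fun i => w i.succ) (w 0)] : DefP fun v => ∃ x, P v x := by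
  constructor
  convert hP.out.image_comp (Fin.succ : Fin n → Fin (n + 1)) using 1
  ext v
  constructor
  · rintro ⟨x, hx⟩
    exact ⟨Fin.cons x v, by simpa using! hx, by ext i; simp⟩
  · rintro ⟨w, hw, rfl⟩
    exact ⟨w 0, hw⟩

instance {P : (Fin n → M) → M → Prop} [hP : DefP fun w : Fin (n + 1) → M =>
    P (fun i => w i.succ) (w 0)] : DefP fun v => ∀ x, P v x :=
  DefP.congr (P := fun v => ¬ ∃ x, ¬ P v x) inferInstance fun v => by simp

instance : DefP fun v : Fin 2 → M => v 0 ∈ₛ v 1 := by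
  constructor
  refine Set.Definable.mono (A := ∅) ?_ (Set.empty_subset _)
  rw [Set.empty_definable_iff]
  refine ⟨FirstOrder.Language.Relations.formula₂ (L := setLang) SetTheoryRel.mem
    (FirstOrder.Language.Term.var 0) (FirstOrder.Language.Term.var 1), ?_⟩
  ext v
  exact (FirstOrder.Language.Formula.realize_rel₂ (L := setLang) (R := (SetTheoryRel.mem : setLang.Relations 2))
    (t₁ := FirstOrder.Language.Term.var 0) (t₂ := FirstOrder.Language.Term.var 1) (v := v)).symm

instance (i : Fin n) : DefF fun v : Fin n → M => v i := ⟨Set.DefinableFun.proj _⟩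

instance (c : M) : DefF fun _ : Fin n → M => c :=
  ⟨FirstOrder.Language.definableFun_const _ _ (Set.mem_univ c)⟩

instance [hf : DefF f] [hg : DefF g] : DefP fun v => f v = g v :=
  ⟨hf.out.ofPred_eq hg.out⟩

instance [hf : DefF f] [hg : DefF g] : DefP fun v => f v ∈ₛ g v :=
  DefP.comp (P := fun v : Fin 2 → M => v 0 ∈ₛ v 1) inferInstance ![f, g]
    (by intro i; fin_cases i <;> assumption)

theorem DefF.comp {f : (Fin m → M) → M} (hf : DefF f) (F : Fin m → (Fin n → M) → M)
    (hF : ∀ i, DefF (F i)) : DefF fun v => f fun i => F i v :=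
  ⟨Set.DefinableFun.comp (g := fun v i => F i v) (fun i => (hF i).out) hf.out⟩

/-- A function with a definable graph is definable. -/
theorem DefF.of_graph (h : DefP fun w : Fin (n + 1) → M => w 0 = f fun i => w i.succ) :
    DefF f := by
  constructor
  have := h.out.preimage_comp (fun i : Fin (n + 1) => (Fin.cases none some i : Option (Fin n)))
  unfold Set.DefinableFun
  convert this using 1
  ext v
  simp [Function.tupleGraph]
  exact eq_comm

/-- Substitution of variables. It is needed below a quantifier, where a function `f` of the free
variables turns into a function that ignores the bound ones. -/
instance (priority := 900) {f : (Fin n → M) → M} (σ : Fin n → Fin m) [hf : DefF f] :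
    DefF fun w : Fin m → M => f fun i => w (σ i) :=
  hf.comp (fun i w => w (σ i)) inferInstance

theorem DefF₁.comp {F : M → M} (hF : DefF₁ F) (f : (Fin n → M) → M) [DefF f] :
    DefF fun v => F (f v) :=
  DefF.comp hF (fun _ => f) inferInstance

instance [DefF f] [DefF g] : DefP fun v => f v ⊆ₛ g v := by unfold Sub; infer_instance
instance [DefF f] : DefP fun v => IsEmp (f v) := by unfold IsEmp; infer_instance
instance [DefF f] [DefF g] : DefP fun v => IsSucc (f v) (g v) := by unfold IsSucc; infer_instance
instance [DefF f] : DefP fun v => IsInductive (f v) := by unfold IsInductive; infer_instance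
instance {h : (Fin n → M) → M} [DefF f] [DefF g] [DefF h] :
    DefP fun v => IsUPair (f v) (g v) (h v) := by unfold IsUPair; infer_instance
instance {h : (Fin n → M) → M} [DefF f] [DefF g] [DefF h] :
    DefP fun v => IsPair (f v) (g v) (h v) := by unfold IsPair; infer_instance
instance {h : (Fin n → M) → M} [DefF f] [DefF g] [DefF h] :
    DefP fun v => App (f v) (g v) (h v) := by unfold App; infer_instance
instance {h : (Fin n → M) → M} [DefF f] [DefF g] [DefF h] :
    DefP fun v => IsFun (f v) (g v) (h v) := by unfold IsFun ExistsUnique; infer_instance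
instance {h : (Fin n → M) → M} [DefF f] [DefF g] [DefF h] :
    DefP fun v => IsSurj (f v) (g v) (h v) := by unfold IsSurj; infer_instance
instance {h : (Fin n → M) → M} [DefF f] [DefF g] [DefF h] :
    DefP fun v => IsBij (f v) (g v) (h v) := by unfold IsBij; infer_instance
instance [DefF f] : DefP fun v => IsTrans (f v) := by unfold IsTrans; infer_instance
instance [DefF f] : DefP fun v => IsOrd (f v) := by unfold IsOrd; infer_instance

end Instances
end ZFModel

/-! ### Class terms and elementary set theory in a model -/

namespace ZFModel

variable {M : Type u} [setLang.Structure M]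

theorem Sub.trans {x y z : M} (h : x ⊆ₛ y) (h' : y ⊆ₛ z) : x ⊆ₛ z := fun w hw => h' w (h w hw)

theorem Sub.refl (x : M) : x ⊆ₛ x := fun _ h => h

variable (M) in
/-- `M` is a model of `ZF`, as a class, so that set terms can be used without carrying the
hypothesis along. -/
class ZF : Prop where
  model : IsModelOfZF M

variable [hZF : ZF M]

instance : Nonempty M := ⟨(hZF.model.infinity).choose⟩

theorem ext {x y : M} (h : ∀ z, z ∈ₛ x ↔ z ∈ₛ y) : x = y := hZF.model.extensionality x y h

open Classical in
/-- The set `{z | P z}` of `M`, if there is one, and an arbitrary element of `M` otherwise. All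
set-forming operations below are instances of it. -/
noncomputable def cls (P : M → Prop) : M :=
  if h : ∃ b, ∀ z, z ∈ₛ b ↔ P z then h.choose else Classical.arbitrary M

theorem mem_cls {P : M → Prop} (h : ∃ b, ∀ z, z ∈ₛ b ↔ P z) {z : M} : z ∈ₛ cls P ↔ P z := by
  rw [cls, dif_pos h]
  exact h.choose_spec z

/-- All set terms are definable functions of their parameters, by this instance. -/
instance {n : ℕ} {P : (Fin n → M) → M → Prop} [hP : DefP fun w : Fin (n + 1) → M =>
    P (fun i => w i.succ) (w 0)] : DefF fun v => cls (P v) := by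
  apply DefF.of_graph
  have h2 : DefP fun w : Fin (n + 2) → M => P (fun i => w i.succ.succ) (w 0) :=
    DefP.comp hP (Fin.cases (fun w : Fin (n + 2) → M => w 0) fun i w => w i.succ.succ)
      (by intro i; cases i using Fin.cases <;> simp only [Fin.cases_zero, Fin.cases_succ] <;>
            infer_instance)
  have h3 : DefP fun w : Fin (n + 3) → M => P (fun i => w i.succ.succ.succ) (w 0) :=
    DefP.comp hP (Fin.cases (fun w : Fin (n + 3) → M => w 0) fun i w => w i.succ.succ.succ)
      (by intro i; cases i using Fin.cases <;> simp only [Fin.cases_zero, Fin.cases_succ] <;>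
            infer_instance)
  refine DefP.congr (P := fun w : Fin (n + 1) → M => (∀ z, z ∈ₛ w 0 ↔ P (fun i => w i.succ) z) ∨
    (¬ ∃ b, ∀ z, z ∈ₛ b ↔ P (fun i => w i.succ) z) ∧ w 0 = Classical.arbitrary M)
    inferInstance fun w => ?_
  by_cases h : ∃ b, ∀ z, z ∈ₛ b ↔ P (fun i => w i.succ) z
  · constructor
    · intro e
      left
      rw [e]
      exact fun z => mem_cls h
    · rintro (h' | h')
      · exact ext fun z => (h' z).trans (mem_cls h).symm
      · exact absurd h h'.1
  · constructor
    · intro e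
      right
      exact ⟨h, by rw [e, cls, dif_neg h]⟩
    · rintro (h' | h')
      · exact absurd ⟨_, h'⟩ h
      · rw [h'.2, cls, dif_neg h]

/-- Separation: a definable subclass of a set is a set. -/
theorem mem_cls_of_sub {P : M → Prop} (a : M) (ha : ∀ z, P z → z ∈ₛ a) [hP : Def₁ P] {z : M} :
    z ∈ₛ cls P ↔ P z := by
  refine mem_cls ?_
  obtain ⟨b, hb⟩ := hZF.model.separation {z | P z} hP.out a
  exact ⟨b, fun z => (hb z).trans ⟨fun h => h.2, fun h => ⟨ha z h, h⟩⟩⟩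

/-! #### Set operations -/

variable (M) in
/-- The empty set. -/
noncomputable def emp : M := cls fun _ => False
/-- `{x, y}`. -/
noncomputable def upair (x y : M) : M := cls fun z => z = x ∨ z = y
/-- `⟨x, y⟩`. -/
noncomputable def opair (x y : M) : M := upair (upair x x) (upair x y)
/-- `⋃ x`. -/
noncomputable def sUnion (x : M) : M := cls fun z => ∃ y, y ∈ₛ x ∧ z ∈ₛ y
/-- `𝒫(x)`. -/
noncomputable def pow (x : M) : M := cls fun z => z ⊆ₛ x
/-- `x ∪ y`. -/
noncomputable def cup (x y : M) : M := cls fun z => z ∈ₛ x ∨ z ∈ₛ y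
/-- `x ∪ {x}`. -/
noncomputable def succ (x : M) : M := cls fun z => z ∈ₛ x ∨ z = x
/-- `{x ∈ a | P x}`. -/
noncomputable def sep (a : M) (P : M → Prop) : M := cls fun z => z ∈ₛ a ∧ P z
/-- `{F x | x ∈ a}`. -/
noncomputable def image (F : M → M) (a : M) : M := cls fun z => ∃ x, x ∈ₛ a ∧ z = F x
/-- `a × b`. -/
noncomputable def prod (a b : M) : M := cls fun z => ∃ x y, x ∈ₛ a ∧ y ∈ₛ b ∧ z = opair x y
/-- The function with domain `a` and values `F x`. -/
noncomputable def lam (a : M) (F : M → M) : M := image (fun x => opair x (F x)) a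
/-- The value `f(x)`. It is written as a union so that it is defined for all `f` and `x`. -/
noncomputable def val (f x : M) : M := cls fun z => ∃ y, App f x y ∧ z ∈ₛ y

section
variable {n : ℕ} {f g : (Fin n → M) → M} [DefF f] [DefF g]

instance : DefF fun v => upair (f v) (g v) := by unfold upair; infer_instance
instance : DefF fun v => opair (f v) (g v) := by unfold opair; infer_instance
instance : DefF fun v => pow (f v) := by unfold pow; infer_instance
instance : DefF fun v => succ (f v) := by unfold succ; infer_instance
instance {P : (Fin n → M) → M → Prop} [DefP fun w : Fin (n + 1) → M =>
    P (fun i => w i.succ) (w 0)] : DefF fun v => sep (f v) (P v) := by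
  unfold sep; infer_instance
instance {F : (Fin n → M) → M → M} [hF : DefF fun w : Fin (n + 1) → M =>
    F (fun i => w i.succ) (w 0)] : DefF fun v => image (F v) (f v) := by
  unfold image
  have : DefF fun w : Fin (n + 2) → M => F (fun i => w i.succ.succ) (w 0) :=
    DefF.comp hF (Fin.cases (fun w : Fin (n + 2) → M => w 0) fun i w => w i.succ.succ)
      (by intro i; cases i using Fin.cases <;> simp only [Fin.cases_zero, Fin.cases_succ] <;>
            infer_instance)
  infer_instance
instance {F : (Fin n → M) → M → M} [hF : DefF fun w : Fin (n + 1) → M =>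
    F (fun i => w i.succ) (w 0)] : DefF fun v => lam (f v) (F v) := by
  unfold lam; infer_instance
instance : DefF fun v => val (f v) (g v) := by unfold val; infer_instance
end

@[simp] theorem mem_upair {x y z : M} : z ∈ₛ upair x y ↔ z = x ∨ z = y :=
  mem_cls (hZF.model.pairing x y)

@[simp] theorem mem_sUnion {x z : M} : z ∈ₛ sUnion x ↔ ∃ y, y ∈ₛ x ∧ z ∈ₛ y :=
  mem_cls (hZF.model.union x)

@[simp] theorem mem_pow {x z : M} : z ∈ₛ pow x ↔ z ⊆ₛ x :=
  mem_cls (hZF.model.powerset x)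

@[simp] theorem not_mem_emp {z : M} : ¬ z ∈ₛ emp M := by
  rw [emp, mem_cls_of_sub (Classical.arbitrary M) (fun _ h => h.elim)]
  exact not_false

@[simp] theorem mem_cup {x y z : M} : z ∈ₛ cup x y ↔ z ∈ₛ x ∨ z ∈ₛ y :=
  mem_cls_of_sub (sUnion (upair x y)) (by
    intro z hz
    simp only [mem_sUnion, mem_upair]
    rcases hz with h | h
    · exact ⟨x, .inl rfl, h⟩
    · exact ⟨y, .inr rfl, h⟩)

@[simp] theorem mem_succ {x z : M} : z ∈ₛ succ x ↔ z ∈ₛ x ∨ z = x :=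
  mem_cls_of_sub (cup x (upair x x)) (by
    intro z hz
    simpa using hz)

@[simp] theorem mem_sep {a : M} {P : M → Prop} [Def₁ P] {z : M} :
    z ∈ₛ sep a P ↔ z ∈ₛ a ∧ P z :=
  mem_cls_of_sub a fun _ h => h.1

@[simp] theorem mem_image {a : M} {F : M → M} [hF : DefF₁ F] {z : M} :
    z ∈ₛ image F a ↔ ∃ x, x ∈ₛ a ∧ z = F x := by
  refine mem_cls ?_
  have : DefF fun v : Fin 2 → M => F (v 0) := DefF₁.comp hF _
  have h : DefP fun v : Fin 2 → M => v 1 = F (v 0) := inferInstance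
  exact hZF.model.replacement {p | p.2 = F p.1} h.out a
    fun x _ => ⟨F x, rfl, fun y hy => hy⟩

theorem isUPair_iff {p x y : M} : IsUPair p x y ↔ p = upair x y :=
  ⟨fun h => ext fun z => by rw [h z, mem_upair], by rintro rfl z; exact mem_upair⟩

theorem isPair_iff {p x y : M} : IsPair p x y ↔ p = opair x y := by
  simp only [IsPair, isUPair_iff]
  exact ⟨fun h => ext fun z => by rw [h z, opair, mem_upair], by rintro rfl z; exact mem_upair⟩

theorem isEmp_iff {x : M} : IsEmp x ↔ x = emp M :=
  ⟨fun h => ext fun z => by simp [h z], by rintro rfl z; exact not_mem_emp⟩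

theorem isSucc_iff {s x : M} : IsSucc s x ↔ s = succ x :=
  ⟨fun h => ext fun z => by rw [h z, mem_succ], by rintro rfl z; exact mem_succ⟩

theorem upair_self_inj {x y : M} (h : upair x x = upair y y) : x = y := by
  have : x ∈ₛ upair y y := h ▸ mem_upair.2 (.inl rfl)
  simpa using this

@[simp] theorem opair_inj {x y x' y' : M} : opair x y = opair x' y' ↔ x = x' ∧ y = y' := by
  constructor
  · intro h
    have mem : ∀ z, z ∈ₛ opair x y ↔ z ∈ₛ opair x' y' := fun z => by rw [h]
    simp only [opair, mem_upair] at mem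
    have hx : x = x' := by
      rcases (mem (upair x x)).1 (.inl rfl) with h1 | h1
      · exact upair_self_inj h1
      · have : x' ∈ₛ upair x x := h1 ▸ mem_upair.2 (.inl rfl)
        exact (by simpa using this : x' = x).symm
    subst hx
    refine ⟨rfl, ?_⟩
    have key : ∀ {y y' : M}, (∀ z, z = upair x x ∨ z = upair x y ↔ z = upair x x ∨ z = upair x y') →
        y = x ∨ y = y' := by
      intro y y' mem
      rcases (mem (upair x y)).1 (.inr rfl) with h1 | h1
      · have : y ∈ₛ upair x x := h1 ▸ mem_upair.2 (.inr rfl)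
        left; simpa using this
      · have : y ∈ₛ upair x y' := h1 ▸ mem_upair.2 (.inr rfl)
        simpa using this
    rcases key mem with h1 | h1
    · rcases key (fun z => (mem z).symm) with h2 | h2
      · rw [h1, h2]
      · exact h2.symm
    · exact h1
  · rintro ⟨rfl, rfl⟩
    rfl

theorem app_iff {f x y : M} : App f x y ↔ opair x y ∈ₛ f := by
  simp only [App, isPair_iff]
  exact ⟨by rintro ⟨p, rfl, h⟩; exact h, fun h => ⟨_, rfl, h⟩⟩

@[simp] theorem mem_prod {a b z : M} :
    z ∈ₛ prod a b ↔ ∃ x y, x ∈ₛ a ∧ y ∈ₛ b ∧ z = opair x y := by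
  refine mem_cls ⟨sUnion (image (fun x => image (fun y => opair x y) b) a), fun z => ?_⟩
  simp only [mem_sUnion, mem_image]
  constructor
  · rintro ⟨_, ⟨x, hx, rfl⟩, h⟩
    obtain ⟨y, hy, rfl⟩ := mem_image.1 h
    exact ⟨x, y, hx, hy, rfl⟩
  · rintro ⟨x, y, hx, hy, rfl⟩
    exact ⟨_, ⟨x, hx, rfl⟩, mem_image.2 ⟨y, hy, rfl⟩⟩

theorem opair_mem_prod {a b x y : M} : opair x y ∈ₛ prod a b ↔ x ∈ₛ a ∧ y ∈ₛ b := by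
  simp only [mem_prod, opair_inj]
  exact ⟨by rintro ⟨_, _, h1, h2, rfl, rfl⟩; exact ⟨h1, h2⟩, fun h => ⟨x, y, h.1, h.2, rfl, rfl⟩⟩

/-! #### Functions -/

theorem app_lam {a : M} {F : M → M} [DefF₁ F] {x y : M} :
    App (lam a F) x y ↔ x ∈ₛ a ∧ y = F x := by
  rw [app_iff, lam, mem_image]
  simp only [opair_inj]
  exact ⟨by rintro ⟨_, h, rfl, rfl⟩; exact ⟨h, rfl⟩, fun h => ⟨x, h.1, rfl, h.2⟩⟩

theorem val_eq {f x y : M} (h : App f x y) (hu : ∀ y', App f x y' → y' = y) : val f x = y := by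
  refine ext fun z => ?_
  rw [val, mem_cls_of_sub y]
  · exact ⟨by rintro ⟨y', h', hz⟩; exact hu y' h' ▸ hz, fun hz => ⟨y, h, hz⟩⟩
  · rintro z ⟨y', h', hz⟩
    exact hu y' h' ▸ hz

theorem val_lam {a : M} {F : M → M} [DefF₁ F] {x : M} (h : x ∈ₛ a) : val (lam a F) x = F x :=
  val_eq (app_lam.2 ⟨h, rfl⟩) fun _ h' => (app_lam.1 h').2

theorem lam_congr {a : M} {F G : M → M} [DefF₁ F] [DefF₁ G] (h : ∀ x, x ∈ₛ a → F x = G x) :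
    lam a F = lam a G := by
  refine ext fun z => ?_
  simp only [lam, mem_image]
  exact ⟨by rintro ⟨x, hx, rfl⟩; exact ⟨x, hx, by rw [h x hx]⟩,
    by rintro ⟨x, hx, rfl⟩; exact ⟨x, hx, by rw [h x hx]⟩⟩

theorem isFun_lam {a b : M} {F : M → M} [DefF₁ F] (h : ∀ x, x ∈ₛ a → F x ∈ₛ b) :
    IsFun (lam a F) a b := by
  refine ⟨fun p hp => ?_, fun x hx => ⟨F x, app_lam.2 ⟨hx, rfl⟩, fun y hy => (app_lam.1 hy).2⟩⟩
  obtain ⟨x, hx, rfl⟩ := mem_image.1 hp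
  exact ⟨x, F x, hx, h x hx, isPair_iff.2 rfl⟩

theorem IsFun.mem {f a b x y : M} (hf : IsFun f a b) (h : App f x y) : x ∈ₛ a ∧ y ∈ₛ b := by
  obtain ⟨p, hp, hpf⟩ := h
  obtain ⟨x', y', hx, hy, hp'⟩ := hf.1 p hpf
  rw [isPair_iff] at hp hp'
  obtain ⟨rfl, rfl⟩ := opair_inj.1 (hp.symm.trans hp')
  exact ⟨hx, hy⟩

theorem IsFun.app_val {f a b x : M} (hf : IsFun f a b) (hx : x ∈ₛ a) : App f x (val f x) := by
  obtain ⟨y, hy, hu⟩ := hf.2 x hx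
  rwa [val_eq hy hu]

theorem IsFun.app_iff {f a b x y : M} (hf : IsFun f a b) :
    App f x y ↔ x ∈ₛ a ∧ y = val f x := by
  constructor
  · intro h
    have hx := (hf.mem h).1
    exact ⟨hx, (hf.2 x hx).unique h (hf.app_val hx)⟩
  · rintro ⟨hx, rfl⟩
    exact hf.app_val hx

theorem IsFun.val_mem {f a b x : M} (hf : IsFun f a b) (hx : x ∈ₛ a) : val f x ∈ₛ b :=
  (hf.mem (hf.app_val hx)).2

theorem IsFun.eq_lam {f a b : M} (hf : IsFun f a b) : f = lam a (val f) := by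
  refine ext fun p => ?_
  rw [lam, mem_image]
  constructor
  · intro hp
    obtain ⟨x, y, hx, -, h⟩ := hf.1 p hp
    exact ⟨x, hx, by rw [isPair_iff.1 h, (hf.app_iff.1 ⟨p, h, hp⟩).2]⟩
  · rintro ⟨x, hx, rfl⟩
    exact ZFModel.app_iff.1 (hf.app_val hx)

theorem IsFun.ext {f g a b c : M} (hf : IsFun f a b) (hg : IsFun g a c)
    (h : ∀ x, x ∈ₛ a → val f x = val g x) : f = g := by
  rw [hf.eq_lam, hg.eq_lam]
  exact lam_congr h

theorem isSurj_lam {a b : M} {F : M → M} [DefF₁ F] (h : ∀ x, x ∈ₛ a → F x ∈ₛ b)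
    (h' : ∀ y, y ∈ₛ b → ∃ x, x ∈ₛ a ∧ y = F x) : IsSurj (lam a F) a b :=
  ⟨isFun_lam h, fun y hy => let ⟨x, hx, e⟩ := h' y hy; ⟨x, hx, app_lam.2 ⟨hx, e⟩⟩⟩

theorem IsSurj.exists_val {f a b y : M} (hf : IsSurj f a b) (hy : y ∈ₛ b) :
    ∃ x, x ∈ₛ a ∧ y = val f x :=
  let ⟨x, _, h⟩ := hf.2 y hy
  ⟨x, hf.1.app_iff.1 h⟩

/-! #### Foundation -/

theorem mem_irrefl (x : M) : ¬ x ∈ₛ x := by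
  intro h
  obtain ⟨y, hy, hy'⟩ := hZF.model.foundation (upair x x) ⟨x, by simp⟩
  obtain rfl : y = x := by simpa using hy
  exact hy' y (by simp) h

theorem mem_asymm {x y : M} (h : x ∈ₛ y) : ¬ y ∈ₛ x := by
  intro h'
  obtain ⟨z, hz, hz'⟩ := hZF.model.foundation (upair x y) ⟨x, by simp⟩
  rcases mem_upair.1 hz with rfl | rfl
  · exact hz' y (by simp) h'
  · exact hz' x (by simp) h

theorem succ_inj {x y : M} (h : succ x = succ y) : x = y := by
  have h1 : x ∈ₛ succ y := h ▸ mem_succ.2 (.inr rfl)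
  have h2 : y ∈ₛ succ x := h ▸ mem_succ.2 (.inr rfl)
  rcases mem_succ.1 h1 with h1 | h1
  · rcases mem_succ.1 h2 with h2 | h2
    · exact absurd h2 (mem_asymm h1)
    · exact h2.symm
  · exact h1

theorem Sub.antisymm {x y : M} (h : x ⊆ₛ y) (h' : y ⊆ₛ x) : x = y :=
  ZFModel.ext fun z => ⟨h z, h' z⟩

end ZFModel

/-! ### Ordinals, recursion and the cumulative hierarchy -/

namespace ZFModel

variable {M : Type u} [setLang.Structure M]

theorem IsOrd.sub {a b : M} (ha : IsOrd a) (h : b ∈ₛ a) : b ⊆ₛ a := ha.1 b h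

theorem IsOrd.mem {a b : M} (ha : IsOrd a) (h : b ∈ₛ a) : IsOrd b :=
  ⟨ha.2 b h, fun c hc => ha.2 c (ha.1 b h c hc)⟩

theorem IsOrd.mem_trans {a b c : M} (hc : IsOrd c) (h : a ∈ₛ b) (h' : b ∈ₛ c) : a ∈ₛ c :=
  hc.1 b h' a h

variable [hZF : ZF M]

theorem isOrd_emp : IsOrd (emp M) := ⟨fun _ h => absurd h not_mem_emp, fun _ h => absurd h not_mem_emp⟩

theorem IsOrd.isOrd_succ {a : M} (ha : IsOrd a) : IsOrd (succ a) := by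
  constructor
  · intro y hy z hz
    rcases mem_succ.1 hy with h | rfl
    · exact mem_succ.2 (.inl (ha.mem_trans hz h))
    · exact mem_succ.2 (.inl hz)
  · intro y hy
    rcases mem_succ.1 hy with h | rfl
    · exact ha.2 y h
    · exact ha.1

theorem isOrd_sUnion {x : M} (h : ∀ a, a ∈ₛ x → IsOrd a) : IsOrd (sUnion x) := by
  constructor
  · intro y hy z hz
    obtain ⟨a, ha, hya⟩ := mem_sUnion.1 hy
    exact mem_sUnion.2 ⟨a, ha, (h a ha).mem_trans hz hya⟩
  · intro y hy
    obtain ⟨a, ha, hya⟩ := mem_sUnion.1 hy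
    exact (h a ha).2 y hya

/-- A nonempty definable class of ordinals has a least element. -/
theorem IsOrd.exists_least {P : M → Prop} [Def₁ P] {a : M} (ha : IsOrd a) (h : P a) :
    ∃ b, IsOrd b ∧ P b ∧ (∀ c, c ∈ₛ b → ¬ P c) ∧ b ∈ₛ succ a := by
  obtain ⟨b, hb, hmin⟩ := hZF.model.foundation (sep (succ a) P) ⟨a, by simp [h]⟩
  rw [mem_sep] at hb
  refine ⟨b, ha.isOrd_succ.mem hb.1, hb.2, fun c hc hP => ?_, hb.1⟩
  exact hmin c (mem_sep.2 ⟨ha.isOrd_succ.mem_trans hc hb.1, hP⟩) hc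

/-- Transfinite induction for definable properties. -/
theorem IsOrd.induction {P : M → Prop} [Def₁ P]
    (h : ∀ a, IsOrd a → (∀ b, b ∈ₛ a → P b) → P a) {a : M} (ha : IsOrd a) : P a := by
  by_contra hP
  obtain ⟨b, hb, hPb, hmin, -⟩ := ha.exists_least (P := fun a => ¬ P a) hP
  exact hPb (h b hb fun c hc => by_contra fun hPc => hmin c hc hPc)

/-- Ordinals are comparable. With ordinals defined as transitive sets of transitive sets, this takes
a double induction. -/
theorem IsOrd.trichotomy {a b : M} (ha : IsOrd a) (hb : IsOrd b) : a ∈ₛ b ∨ a = b ∨ b ∈ₛ a := by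
  refine ha.induction (P := fun a => ∀ b, IsOrd b → a ∈ₛ b ∨ a = b ∨ b ∈ₛ a) ?_ b hb
  intro a ha iha b hb
  refine hb.induction (P := fun b => a ∈ₛ b ∨ a = b ∨ b ∈ₛ a) ?_
  intro b hb ihb
  by_contra hne
  push Not at hne
  refine hne.2.1 (ext fun z => ⟨fun hz => ?_, fun hz => ?_⟩)
  · rcases iha z hz b hb with h | rfl | h
    · exact h
    · exact absurd hz hne.2.2
    · exact absurd (ha.mem_trans h hz) hne.2.2
  · rcases ihb z hz with h | rfl | h
    · exact absurd (hb.mem_trans h hz) hne.1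
    · exact absurd hz hne.1
    · exact h

theorem IsOrd.not_mem_iff {a b : M} (ha : IsOrd a) (hb : IsOrd b) : ¬ a ∈ₛ b ↔ b ⊆ₛ a := by
  constructor
  · intro h
    rcases ha.trichotomy hb with h' | rfl | h'
    · exact absurd h' h
    · exact Sub.refl _
    · exact ha.sub h'
  · intro h h'
    exact mem_irrefl a (h a h')

theorem IsOrd.eq_or_mem_of_sub {a b : M} (ha : IsOrd a) (hb : IsOrd b) (h : a ⊆ₛ b) :
    a = b ∨ a ∈ₛ b := by
  rcases ha.trichotomy hb with h' | h' | h'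
  · exact .inr h'
  · exact .inl h'
  · exact absurd (h b h') (mem_irrefl b)

theorem IsOrd.mem_of_sub_of_mem {a b c : M} (ha : IsOrd a) (hc : IsOrd c) (h : a ⊆ₛ b)
    (hb : b ∈ₛ c) : a ∈ₛ c := by
  rcases ha.eq_or_mem_of_sub (hc.mem hb) h with rfl | h'
  · exact hb
  · exact hc.mem_trans h' hb

theorem IsOrd.sub_total {a b : M} (ha : IsOrd a) (hb : IsOrd b) : a ⊆ₛ b ∨ b ⊆ₛ a := by
  by_cases h : a ∈ₛ b
  · exact .inl (hb.sub h)
  · exact .inr ((ha.not_mem_iff hb).1 h)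

/-! #### Natural numbers -/

theorem IsInductive.emp_mem {w : M} (h : IsInductive w) : emp M ∈ₛ w := by
  obtain ⟨⟨e, he, hw⟩, -⟩ := h
  rwa [← isEmp_iff.1 he]

theorem IsInductive.succ_mem {w x : M} (h : IsInductive w) (hx : x ∈ₛ w) : succ x ∈ₛ w := by
  obtain ⟨s, hs, hw⟩ := h.2 x hx
  rwa [← isSucc_iff.1 hs]

theorem isInductive_of {w : M} (h : emp M ∈ₛ w) (hs : ∀ x, x ∈ₛ w → succ x ∈ₛ w) :
    IsInductive w :=
  ⟨⟨_, isEmp_iff.2 rfl, h⟩, fun x hx => ⟨_, isSucc_iff.2 rfl, hs x hx⟩⟩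

variable (M) in
/-- The set `ω`. -/
noncomputable def om : M := cls fun n => ∀ w, IsInductive w → n ∈ₛ w

theorem mem_om {n : M} : n ∈ₛ om M ↔ ∀ w, IsInductive w → n ∈ₛ w := by
  obtain ⟨w, hw⟩ := hZF.model.infinity
  exact mem_cls_of_sub w fun z hz => hz w hw

theorem emp_mem_om : emp M ∈ₛ om M := mem_om.2 fun _ h => h.emp_mem

theorem succ_mem_om {n : M} (hn : n ∈ₛ om M) : succ n ∈ₛ om M :=
  mem_om.2 fun w h => h.succ_mem (mem_om.1 hn w h)

theorem isOmega_om : IsOmega (om M) :=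
  ⟨isInductive_of emp_mem_om fun _ => succ_mem_om, fun v hv _ hn => mem_om.1 hn v hv⟩

theorem isOmega_iff {w : M} : IsOmega w ↔ w = om M :=
  ⟨fun h => (h.2 _ isOmega_om.1).antisymm (isOmega_om.2 _ h.1), by rintro rfl; exact isOmega_om⟩

theorem om_induction {P : M → Prop} [Def₁ P] (h0 : P (emp M))
    (hs : ∀ n, n ∈ₛ om M → P n → P (succ n)) {n : M} (hn : n ∈ₛ om M) : P n := by
  have : IsInductive (sep (om M) P) :=
    isInductive_of (mem_sep.2 ⟨emp_mem_om, h0⟩) fun x hx => by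
      rw [mem_sep] at hx ⊢
      exact ⟨succ_mem_om hx.1, hs x hx.1 hx.2⟩
  exact (mem_sep.1 (mem_om.1 hn _ this)).2

theorem isOrd_of_mem_om {n : M} (hn : n ∈ₛ om M) : IsOrd n :=
  om_induction (P := IsOrd) isOrd_emp (fun _ _ h => h.isOrd_succ) hn

theorem isOrd_om : IsOrd (om M) := by
  refine ⟨fun n hn => ?_, fun n hn => (isOrd_of_mem_om hn).1⟩
  refine om_induction (P := fun n => n ⊆ₛ om M) (fun z hz => absurd hz not_mem_emp) ?_ hn
  intro n hn ih z hz
  rcases mem_succ.1 hz with h | rfl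
  · exact ih z h
  · exact hn

/-! #### Recursion -/

/-- `f` is a function on the ordinal `a` obeying the recursion `f(b) = G(f ↾ b)`. -/
def IsRecFun (G : M → M) (f a : M) : Prop :=
  f = lam a (val f) ∧ ∀ b, b ∈ₛ a → val f b = G (lam b (val f))

/-- The class function on the ordinals defined by the recursion `F(a) = G(F ↾ a)`. The argument of
`G` is the unique `f` with `IsRecFun G f a`, written as a union to have a set term for it. -/
noncomputable def recOrd (G : M → M) (a : M) : M :=
  G (cls fun z => ∃ f, IsRecFun G f a ∧ z ∈ₛ f)

instance {n : ℕ} {G : M → M} [hG : DefF₁ G] {f g : (Fin n → M) → M} [DefF f] [DefF g] :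
    DefP fun v => IsRecFun G (f v) (g v) := by
  have h {m : ℕ} (f : (Fin m → M) → M) [DefF f] : DefF fun v => G (f v) := hG.comp f
  unfold IsRecFun
  infer_instance

instance {n : ℕ} {G : M → M} [hG : DefF₁ G] {f : (Fin n → M) → M} [DefF f] :
    DefF fun v => recOrd G (f v) := by
  have h {m : ℕ} (f : (Fin m → M) → M) [DefF f] : DefF fun v => G (f v) := hG.comp f
  unfold recOrd
  infer_instance

theorem recOrd_eq {G : M → M} [hG : DefF₁ G] {a : M} (ha : IsOrd a) :
    recOrd G a = G (lam a (recOrd G)) := by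
  have h {m : ℕ} (f : (Fin m → M) → M) [DefF f] : DefF fun v => G (f v) := hG.comp f
  have uniq : ∀ {a f g : M}, IsOrd a → IsRecFun G f a → IsRecFun G g a → f = g := by
    intro a f g ha hf hg
    have key : ∀ b, IsOrd b → (b ∈ₛ a → val f b = val g b) := fun b hb => by
      refine hb.induction (P := fun b => b ∈ₛ a → val f b = val g b) fun b _ ih hba => ?_
      rw [hf.2 b hba, hg.2 b hba]
      congr 1
      exact lam_congr fun c hc => ih c hc (ha.mem_trans hc hba)
    rw [hf.1, hg.1]
    exact lam_congr fun b hb => key b (ha.mem hb) hb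
  have rec_of : ∀ {a f : M}, IsOrd a → IsRecFun G f a → recOrd G a = G f := by
    intro a f ha hf
    unfold recOrd
    congr 1
    refine ext fun z => ?_
    rw [mem_cls_of_sub f]
    · exact ⟨by rintro ⟨g, hg, hz⟩; exact uniq ha hg hf ▸ hz, fun hz => ⟨f, hf, hz⟩⟩
    · rintro z ⟨g, hg, hz⟩
      exact uniq ha hg hf ▸ hz
  have ex : IsRecFun G (lam a (recOrd G)) a := by
    refine ha.induction (P := fun a => IsRecFun G (lam a (recOrd G)) a) fun a ha ih => ?_
    refine ⟨lam_congr fun b hb => (val_lam hb).symm, fun b hb => ?_⟩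
    rw [val_lam hb, rec_of (ha.mem hb) (ih b hb)]
    congr 1
    exact lam_congr fun c hc => (val_lam (ha.mem_trans hc hb)).symm
  exact rec_of ha ex

/-! #### The cumulative hierarchy -/

/-- The level `V_a`. -/
noncomputable def V (a : M) : M :=
  recOrd (fun f => cls fun z => ∃ c t, App f c t ∧ z ⊆ₛ t) a

instance {n : ℕ} {f : (Fin n → M) → M} [DefF f] : DefF fun v => V (f v) := by
  unfold V; infer_instance

theorem mem_V {a z : M} (ha : IsOrd a) : z ∈ₛ V a ↔ ∃ b, b ∈ₛ a ∧ z ⊆ₛ V b := by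
  unfold V
  rw [recOrd_eq ha]
  have hF : DefF₁ fun b : M => recOrd (fun f => cls fun z => ∃ c t, App f c t ∧ z ⊆ₛ t) b :=
    inferInstance
  rw [mem_cls_of_sub (sUnion (image (fun b => pow (V b)) a))]
  · constructor
    · rintro ⟨c, t, h, hz⟩
      obtain ⟨hc, rfl⟩ := app_lam.1 h
      exact ⟨c, hc, hz⟩
    · rintro ⟨b, hb, hz⟩
      exact ⟨b, _, app_lam.2 ⟨hb, rfl⟩, hz⟩
  · rintro z ⟨c, t, h, hz⟩
    obtain ⟨hc, rfl⟩ := app_lam.1 h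
    exact mem_sUnion.2 ⟨_, mem_image.2 ⟨c, hc, rfl⟩, mem_pow.2 hz⟩

theorem isV_iff {v a : M} : IsV v a ↔ IsOrd a ∧ v = V a := by
  constructor
  · rintro ⟨ha, h, ⟨⟨r, hr⟩, hs⟩, hv⟩
    refine ⟨ha, ?_⟩
    have key : ∀ b, IsOrd b → (b ∈ₛ a → val h b = V b) := fun b hb => by
      refine hb.induction (P := fun b => b ∈ₛ a → val h b = V b) fun b hb ih hba => ?_
      refine ext fun z => ?_
      rw [hs b _ hba (hr.app_val hba), mem_V hb]
      constructor
      · rintro ⟨c, t, hc, ht, hz⟩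
        rw [(hr.app_iff.1 ht).2, ih c hc (ha.mem_trans hc hba)] at hz
        exact ⟨c, hc, hz⟩
      · rintro ⟨c, hc, hz⟩
        have hca := ha.mem_trans hc hba
        exact ⟨c, _, hc, hr.app_val hca, by rwa [ih c hc hca]⟩
    refine ext fun z => ?_
    rw [hv z, mem_V ha]
    constructor
    · rintro ⟨b, t, hb, ht, hz⟩
      rw [(hr.app_iff.1 ht).2, key b (ha.mem hb) hb] at hz
      exact ⟨b, hb, hz⟩
    · rintro ⟨b, hb, hz⟩
      exact ⟨b, _, hb, hr.app_val hb, by rwa [key b (ha.mem hb) hb]⟩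
  · rintro ⟨ha, rfl⟩
    refine ⟨ha, lam a V, ⟨⟨image V a, isFun_lam fun x hx => mem_image.2 ⟨x, hx, rfl⟩⟩, ?_⟩, ?_⟩
    · intro b v hb hv z
      obtain ⟨-, rfl⟩ := app_lam.1 hv
      rw [mem_V (ha.mem hb)]
      constructor
      · rintro ⟨c, hc, hz⟩
        exact ⟨c, _, hc, app_lam.2 ⟨ha.mem_trans hc hb, rfl⟩, hz⟩
      · rintro ⟨c, t, hc, ht, hz⟩
        obtain ⟨-, rfl⟩ := app_lam.1 ht
        exact ⟨c, hc, hz⟩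
    · intro z
      rw [mem_V ha]
      constructor
      · rintro ⟨c, hc, hz⟩
        exact ⟨c, _, hc, app_lam.2 ⟨hc, rfl⟩, hz⟩
      · rintro ⟨c, t, hc, ht, hz⟩
        obtain ⟨-, rfl⟩ := app_lam.1 ht
        exact ⟨c, hc, hz⟩

theorem V_mono {a b : M} (ha : IsOrd a) (hb : IsOrd b) (h : a ⊆ₛ b) : V a ⊆ₛ V b := by
  intro z hz
  obtain ⟨c, hc, hz⟩ := (mem_V ha).1 hz
  exact (mem_V hb).2 ⟨c, h c hc, hz⟩

theorem isTrans_V {a : M} (ha : IsOrd a) : IsTrans (V a) := by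
  intro y hy z hz
  obtain ⟨b, hb, hyb⟩ := (mem_V ha).1 hy
  exact V_mono (ha.mem hb) ha (ha.sub hb) z (hyb z hz)

theorem mem_V_of_sub {a y z : M} (ha : IsOrd a) (hy : y ∈ₛ V a) (h : z ⊆ₛ y) : z ∈ₛ V a := by
  obtain ⟨b, hb, hyb⟩ := (mem_V ha).1 hy
  exact (mem_V ha).2 ⟨b, hb, h.trans hyb⟩

theorem mem_V_succ {a z : M} (ha : IsOrd a) : z ∈ₛ V (succ a) ↔ z ⊆ₛ V a := by
  rw [mem_V ha.isOrd_succ]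
  constructor
  · rintro ⟨b, hb, hz⟩
    rcases mem_succ.1 hb with hb | rfl
    · exact hz.trans (V_mono (ha.mem hb) ha (ha.sub hb))
    · exact hz
  · intro h
    exact ⟨a, mem_succ.2 (.inr rfl), h⟩

theorem sub_V {a : M} (ha : IsOrd a) : a ⊆ₛ V a := by
  refine ha.induction (P := fun a => a ⊆ₛ V a) fun a ha ih => ?_
  intro b hb
  exact (mem_V ha).2 ⟨b, hb, ih b hb⟩

/-- The ordinals in `V_a` are the elements of `a`. -/
theorem mem_of_mem_V {a d : M} (ha : IsOrd a) (hd : IsOrd d) (h : d ∈ₛ V a) : d ∈ₛ a := by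
  have irr : ¬ a ∈ₛ V a := by
    refine ha.induction (P := fun a => ¬ a ∈ₛ V a) fun a ha ih h => ?_
    obtain ⟨b, hb, hab⟩ := (mem_V ha).1 h
    exact ih b hb (hab b hb)
  by_contra hn
  exact irr (mem_V_of_sub ha h ((hd.not_mem_iff ha).1 hn))

end ZFModel

/-! ### Ranks, limit levels and codes of formulas -/

namespace ZFModel

variable {M : Type u} [setLang.Structure M] [hZF : ZF M]

/-- A set all of whose elements lie in some level of the hierarchy lies in some level itself. -/
theorem exists_mem_V_of {x : M} (h : ∀ y, y ∈ₛ x → ∃ a, IsOrd a ∧ y ∈ₛ V a) :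
    ∃ a, IsOrd a ∧ x ∈ₛ V a := by
  -- `r y` is the least `a` with `y ∈ V_a`
  let r : M → M := fun y =>
    cls fun z => ∃ a, IsOrd a ∧ y ∈ₛ V a ∧ (∀ c, c ∈ₛ a → ¬ y ∈ₛ V c) ∧ z ∈ₛ a
  have hr : DefF₁ r := by unfold r; infer_instance
  have hry : ∀ y, y ∈ₛ x → IsOrd (r y) ∧ y ∈ₛ V (r y) := by
    intro y hy
    obtain ⟨a, ha, hya⟩ := h y hy
    obtain ⟨b, hb, hyb, hmin, -⟩ := ha.exists_least (P := fun a => y ∈ₛ V a) hya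
    have uniq : ∀ a, IsOrd a → y ∈ₛ V a → (∀ c, c ∈ₛ a → ¬ y ∈ₛ V c) → a = b := by
      intro a ha hya hmina
      rcases ha.trichotomy hb with h' | h' | h'
      · exact absurd hya (hmin a h')
      · exact h'
      · exact absurd hyb (hmina b h')
    have : r y = b := by
      refine ext fun z => ?_
      unfold r
      rw [mem_cls_of_sub b]
      · constructor
        · rintro ⟨a, h1, h2, h3, h4⟩
          exact uniq a h1 h2 h3 ▸ h4
        · intro hz
          exact ⟨b, hb, hyb, hmin, hz⟩
      · rintro z ⟨a, h1, h2, h3, h4⟩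
        exact uniq a h1 h2 h3 ▸ h4
    rw [this]
    exact ⟨hb, hyb⟩
  have ho : IsOrd (sUnion (image r x)) := isOrd_sUnion fun a ha => by
    obtain ⟨y, hy, rfl⟩ := mem_image.1 ha
    exact (hry y hy).1
  refine ⟨_, ho.isOrd_succ, (mem_V_succ ho).2 fun y hy => ?_⟩
  refine V_mono (hry y hy).1 ho ?_ y (hry y hy).2
  intro z hz
  exact mem_sUnion.2 ⟨_, mem_image.2 ⟨y, hy, rfl⟩, hz⟩

/-- Every set is included in a transitive set, namely in `⋃ₙ F(n)`, where
`F(n) = x ∪ ⋃ {⋃ F(m) | m < n}`. -/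
theorem exists_isTrans (x : M) : ∃ t : M, IsTrans t ∧ x ⊆ₛ t := by
  let G : M → M := fun f => cls fun z => z ∈ₛ x ∨ ∃ c t y, App f c t ∧ y ∈ₛ t ∧ z ∈ₛ y
  have hG : DefF₁ G := by unfold G; infer_instance
  have hF : ∀ n, n ∈ₛ om M → ∀ z, z ∈ₛ recOrd G n ↔
      z ∈ₛ x ∨ ∃ c y, c ∈ₛ n ∧ y ∈ₛ recOrd G c ∧ z ∈ₛ y := by
    intro n hn z
    rw [recOrd_eq (isOrd_of_mem_om hn)]
    have : ∀ z, (z ∈ₛ x ∨ ∃ c t y, App (lam n (recOrd G)) c t ∧ y ∈ₛ t ∧ z ∈ₛ y) ↔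
        (z ∈ₛ x ∨ ∃ c y, c ∈ₛ n ∧ y ∈ₛ recOrd G c ∧ z ∈ₛ y) := by
      intro z
      constructor
      · rintro (h | ⟨c, t, y, h, hy, hz⟩)
        · exact .inl h
        · obtain ⟨hc, rfl⟩ := app_lam.1 h
          exact .inr ⟨c, y, hc, hy, hz⟩
      · rintro (h | ⟨c, y, hc, hy, hz⟩)
        · exact .inl h
        · exact .inr ⟨c, _, y, app_lam.2 ⟨hc, rfl⟩, hy, hz⟩
    rw [← this z]
    refine mem_cls_of_sub (cup x (sUnion (sUnion (image (recOrd G) n)))) fun z hz => ?_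
    rw [mem_cup]
    refine ((this z).1 hz).imp id ?_
    rintro ⟨c, y, hc, hy, hz⟩
    exact mem_sUnion.2 ⟨y, mem_sUnion.2 ⟨_, mem_image.2 ⟨c, hc, rfl⟩, hy⟩, hz⟩
  refine ⟨sUnion (image (recOrd G) (om M)), ?_, ?_⟩
  · intro y hy z hz
    obtain ⟨_, hm, hy⟩ := mem_sUnion.1 hy
    obtain ⟨n, hn, rfl⟩ := mem_image.1 hm
    exact mem_sUnion.2 ⟨_, mem_image.2 ⟨succ n, succ_mem_om hn, rfl⟩,
      (hF _ (succ_mem_om hn) z).2 (.inr ⟨n, y, mem_succ.2 (.inr rfl), hy, hz⟩)⟩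
  · intro z hz
    exact mem_sUnion.2 ⟨_, mem_image.2 ⟨emp M, emp_mem_om, rfl⟩, (hF _ emp_mem_om z).2 (.inl hz)⟩

/-- Every set lies in some level of the hierarchy, by foundation applied inside a transitive set. -/
theorem exists_mem_V (x : M) : ∃ a, IsOrd a ∧ x ∈ₛ V a := by
  refine exists_mem_V_of fun y hy => ?_
  by_contra hy'
  obtain ⟨t, ht, hxt⟩ := exists_isTrans x
  obtain ⟨z, hz, hmin⟩ := hZF.model.foundation (sep t fun z => ¬ ∃ a, IsOrd a ∧ z ∈ₛ V a)
    ⟨y, mem_sep.2 ⟨hxt y hy, hy'⟩⟩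
  rw [mem_sep] at hz
  refine hz.2 (exists_mem_V_of fun w hw => ?_)
  by_contra hw'
  exact hmin w (mem_sep.2 ⟨ht z hz.1 w hw, hw'⟩) hw

/-! #### Limit ordinals -/

/-- `a` is a nonzero limit ordinal. -/
structure IsLim (a : M) : Prop where
  isOrd : IsOrd a
  emp_mem : emp M ∈ₛ a
  succ_mem : ∀ b, b ∈ₛ a → succ b ∈ₛ a

theorem isLim_om : IsLim (om M) := ⟨isOrd_om, emp_mem_om, fun _ => succ_mem_om⟩

/-- There are arbitrarily large limit ordinals: take `⋃ₙ F(n)`, where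
`F(n) = (a + 1) ∪ ⋃ {F(m) + 1 | m < n}`. -/
theorem exists_isLim {a : M} (ha : IsOrd a) : ∃ b, IsLim b ∧ a ∈ₛ b := by
  let G : M → M := fun f => cls fun z => z ∈ₛ succ a ∨ ∃ c t, App f c t ∧ z ∈ₛ succ t
  have hG : DefF₁ G := by unfold G; infer_instance
  have hF : ∀ n, n ∈ₛ om M → ∀ z, z ∈ₛ recOrd G n ↔
      z ∈ₛ succ a ∨ ∃ c, c ∈ₛ n ∧ z ∈ₛ succ (recOrd G c) := by
    intro n hn z
    rw [recOrd_eq (isOrd_of_mem_om hn)]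
    have : ∀ z, (z ∈ₛ succ a ∨ ∃ c t, App (lam n (recOrd G)) c t ∧ z ∈ₛ succ t) ↔
        (z ∈ₛ succ a ∨ ∃ c, c ∈ₛ n ∧ z ∈ₛ succ (recOrd G c)) := by
      intro z
      constructor
      · rintro (h | ⟨c, t, h, hz⟩)
        · exact .inl h
        · obtain ⟨hc, rfl⟩ := app_lam.1 h
          exact .inr ⟨c, hc, hz⟩
      · rintro (h | ⟨c, hc, hz⟩)
        · exact .inl h
        · exact .inr ⟨c, _, app_lam.2 ⟨hc, rfl⟩, hz⟩
    rw [← this z]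
    refine mem_cls_of_sub (cup (succ a) (sUnion (image (fun c => succ (recOrd G c)) n)))
      fun z hz => ?_
    rw [mem_cup]
    refine ((this z).1 hz).imp id ?_
    rintro ⟨c, hc, hz⟩
    exact mem_sUnion.2 ⟨_, mem_image.2 ⟨c, hc, rfl⟩, hz⟩
  have hord : ∀ n, n ∈ₛ om M → IsOrd (recOrd G n) := by
    intro n hn
    refine (isOrd_of_mem_om hn).induction (P := fun n => n ∈ₛ om M → IsOrd (recOrd G n)) ?_ hn
    intro n _ ih hn
    have : recOrd G n = sUnion (cup (upair (succ a) (succ a))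
        (image (fun c => succ (recOrd G c)) n)) := by
      refine ext fun z => ?_
      simp only [hF n hn, mem_sUnion, mem_cup, mem_upair, or_self, mem_image]
      constructor
      · rintro (h | ⟨c, hc, hz⟩)
        · exact ⟨_, .inl rfl, h⟩
        · exact ⟨_, .inr ⟨c, hc, rfl⟩, hz⟩
      · rintro ⟨_, rfl | ⟨c, hc, rfl⟩, hz⟩
        · exact .inl hz
        · exact .inr ⟨c, hc, hz⟩
    rw [this]
    refine isOrd_sUnion fun b hb => ?_
    simp only [mem_cup, mem_upair, or_self, mem_image] at hb
    rcases hb with rfl | ⟨c, hc, rfl⟩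
    · exact ha.isOrd_succ
    · exact (ih c hc (isOrd_om.mem_trans hc hn)).isOrd_succ
  have hmem : ∀ z, z ∈ₛ sUnion (image (recOrd G) (om M)) ↔
      ∃ n, n ∈ₛ om M ∧ z ∈ₛ recOrd G n := by
    intro z
    simp only [mem_sUnion, mem_image]
    exact ⟨by rintro ⟨_, ⟨n, hn, rfl⟩, h⟩; exact ⟨n, hn, h⟩,
      by rintro ⟨n, hn, h⟩; exact ⟨_, ⟨n, hn, rfl⟩, h⟩⟩
  have ho : IsOrd (sUnion (image (recOrd G) (om M))) := isOrd_sUnion fun b hb => by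
    obtain ⟨n, hn, rfl⟩ := mem_image.1 hb
    exact hord n hn
  have hab : a ∈ₛ sUnion (image (recOrd G) (om M)) :=
    (hmem a).2 ⟨_, emp_mem_om, (hF _ emp_mem_om a).2 (.inl (mem_succ.2 (.inr rfl)))⟩
  have hsucc : ∀ b, b ∈ₛ sUnion (image (recOrd G) (om M)) →
      succ b ∈ₛ sUnion (image (recOrd G) (om M)) := by
    intro b hb
    obtain ⟨n, hn, hbn⟩ := (hmem b).1 hb
    have hbo := (hord n hn).mem hbn
    refine (hmem _).2 ⟨succ n, succ_mem_om hn, (hF _ (succ_mem_om hn) _).2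
      (.inr ⟨n, mem_succ.2 (.inr rfl), ?_⟩)⟩
    rw [mem_succ]
    rcases hbo.isOrd_succ.eq_or_mem_of_sub (hord n hn) (fun z hz => by
      rcases mem_succ.1 hz with h | rfl
      · exact (hord n hn).mem_trans h hbn
      · exact hbn) with h | h
    · exact .inr h
    · exact .inl h
  refine ⟨_, ⟨ho, ?_, hsucc⟩, hab⟩
  rcases isOrd_emp.trichotomy ho with h | h | h
  · exact h
  · rw [← h] at hab
    exact absurd hab not_mem_emp
  · exact absurd h not_mem_emp

theorem IsLim.exists_sub {a x y : M} (ha : IsLim a) (hx : x ∈ₛ V a) (hy : y ∈ₛ V a) :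
    ∃ b, b ∈ₛ a ∧ x ⊆ₛ V b ∧ y ⊆ₛ V b := by
  obtain ⟨b, hb, hxb⟩ := (mem_V ha.isOrd).1 hx
  obtain ⟨c, hc, hyc⟩ := (mem_V ha.isOrd).1 hy
  have hbo := ha.isOrd.mem hb
  have hco := ha.isOrd.mem hc
  rcases hbo.sub_total hco with h | h
  · exact ⟨c, hc, hxb.trans (V_mono hbo hco h), hyc⟩
  · exact ⟨b, hb, hxb, hyc.trans (V_mono hco hbo h)⟩

theorem IsLim.upair_mem {a x y : M} (ha : IsLim a) (hx : x ∈ₛ V a) (hy : y ∈ₛ V a) :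
    upair x y ∈ₛ V a := by
  obtain ⟨b, hb, hxb, hyb⟩ := ha.exists_sub hx hy
  have hbo := ha.isOrd.mem hb
  refine (mem_V ha.isOrd).2 ⟨succ b, ha.succ_mem b hb, fun z hz => ?_⟩
  rcases mem_upair.1 hz with rfl | rfl
  · exact (mem_V_succ hbo).2 hxb
  · exact (mem_V_succ hbo).2 hyb

theorem IsLim.opair_mem {a x y : M} (ha : IsLim a) (hx : x ∈ₛ V a) (hy : y ∈ₛ V a) :
    opair x y ∈ₛ V a :=
  ha.upair_mem (ha.upair_mem hx hx) (ha.upair_mem hx hy)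

theorem fst_mem_of_opair_mem {a x y : M} (ha : IsTrans a) (h : opair x y ∈ₛ a) : x ∈ₛ a :=
  ha _ (ha _ h (upair x x) (by simp [opair])) x (by simp)

theorem snd_mem_of_opair_mem {a x y : M} (ha : IsTrans a) (h : opair x y ∈ₛ a) : y ∈ₛ a :=
  ha _ (ha _ h (upair x y) (by simp [opair])) y (by simp)

/-- Every set lies in a level `V_b` with `b` a limit above any given ordinal. -/
theorem exists_isLim_mem_V (x : M) {a : M} (ha : IsOrd a) :
    ∃ b, IsLim b ∧ a ∈ₛ b ∧ x ∈ₛ V b := by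
  obtain ⟨c, hc, hxc⟩ := exists_mem_V x
  rcases ha.sub_total hc with h | h
  · obtain ⟨b, hb, hcb⟩ := exists_isLim hc
    exact ⟨b, hb, ha.mem_of_sub_of_mem hb.isOrd h hcb,
      V_mono hc hb.isOrd (hb.isOrd.sub hcb) x hxc⟩
  · obtain ⟨b, hb, hab⟩ := exists_isLim ha
    exact ⟨b, hb, hab,
      V_mono hc hb.isOrd (hb.isOrd.sub (hc.mem_of_sub_of_mem hb.isOrd h hab)) x hxc⟩

/-! #### Numerals and codes of formulas -/

/-- The numeral `n` of `M`. -/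
noncomputable def num : ℕ → M
  | 0 => emp M
  | n + 1 => succ (num n)

theorem isNumeral_iff {n : ℕ} {x : M} : IsNumeral n x ↔ x = num n := by
  induction n generalizing x with
  | zero => exact isEmp_iff
  | succ n ih =>
    simp only [IsNumeral, ih, isSucc_iff, num]
    exact ⟨by rintro ⟨_, rfl, h⟩; exact h, fun h => ⟨_, rfl, h⟩⟩

theorem num_mem_om (n : ℕ) : (num n : M) ∈ₛ om M := by
  induction n with
  | zero => exact emp_mem_om
  | succ n ih => exact succ_mem_om ih

@[simp] theorem num_inj {m n : ℕ} : (num m : M) = num n ↔ m = n := by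
  refine ⟨fun h => ?_, fun h => h ▸ rfl⟩
  induction m generalizing n with
  | zero =>
    cases n with
    | zero => rfl
    | succ n =>
      have : (num n : M) ∈ₛ num 0 := h ▸ mem_succ.2 (.inr rfl)
      exact absurd this not_mem_emp
  | succ m ih =>
    cases n with
    | zero =>
      have : (num m : M) ∈ₛ num 0 := h ▸ mem_succ.2 (.inr rfl)
      exact absurd this not_mem_emp
    | succ n => rw [ih (succ_inj h)]

/-- The code of `vᵢ = vⱼ`. -/
noncomputable def fEq (i j : M) : M := opair (num 0) (opair i j)
/-- The code of `vᵢ ∈ vⱼ`. -/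
noncomputable def fMem (i j : M) : M := opair (num 1) (opair i j)
/-- The code of `¬ a`. -/
noncomputable def fNeg (a : M) : M := opair (num 2) a
/-- The code of `a ∧ b`. -/
noncomputable def fAnd (a b : M) : M := opair (num 3) (opair a b)
/-- The code of `∃ vᵢ a`. -/
noncomputable def fEx (i a : M) : M := opair (num 4) (opair i a)

section
variable {n : ℕ} {f g : (Fin n → M) → M} [DefF f] [DefF g]
instance : DefF fun v => fEq (f v) (g v) := by unfold fEq; infer_instance
instance : DefF fun v => fMem (f v) (g v) := by unfold fMem; infer_instance
instance : DefF fun v => fNeg (f v) := by unfold fNeg; infer_instance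
instance : DefF fun v => fAnd (f v) (g v) := by unfold fAnd; infer_instance
instance : DefF fun v => fEx (f v) (g v) := by unfold fEx; infer_instance
end

theorem isTag_iff {n : ℕ} {c a : M} : IsTag n c a ↔ c = opair (num n) a := by
  simp only [IsTag, isNumeral_iff, isPair_iff]
  exact ⟨by rintro ⟨_, rfl, h⟩; exact h, fun h => ⟨_, rfl, h⟩⟩

theorem isTag₂_iff {n : ℕ} {c a b : M} : IsTag₂ n c a b ↔ c = opair (num n) (opair a b) := by
  simp only [IsTag₂, isTag_iff, isPair_iff]
  exact ⟨by rintro ⟨_, rfl, h⟩; exact h, fun h => ⟨_, rfl, h⟩⟩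

theorem formClosed_iff {S : M} : FormClosed S ↔
    (∀ i j, i ∈ₛ om M → j ∈ₛ om M → fEq i j ∈ₛ S) ∧
    (∀ i j, i ∈ₛ om M → j ∈ₛ om M → fMem i j ∈ₛ S) ∧
    (∀ a, a ∈ₛ S → fNeg a ∈ₛ S) ∧
    (∀ a b, a ∈ₛ S → b ∈ₛ S → fAnd a b ∈ₛ S) ∧
    (∀ i a, i ∈ₛ om M → a ∈ₛ S → fEx i a ∈ₛ S) := by
  simp only [FormClosed, isOmega_iff, isTag_iff, isTag₂_iff]
  constructor
  · intro h
    obtain ⟨h1, h2, h3, h4, h5⟩ := h _ rfl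
    exact ⟨fun i j hi hj => h1 i j _ hi hj rfl, fun i j hi hj => h2 i j _ hi hj rfl,
      fun a ha => h3 a _ ha rfl, fun a b ha hb => h4 a b _ ha hb rfl,
      fun i a hi ha => h5 i a _ hi ha rfl⟩
  · rintro ⟨h1, h2, h3, h4, h5⟩ _ rfl
    refine ⟨?_, ?_, ?_, ?_, ?_⟩
    · rintro i j _ hi hj rfl
      exact h1 i j hi hj
    · rintro i j _ hi hj rfl
      exact h2 i j hi hj
    · rintro a _ ha rfl
      exact h3 a ha
    · rintro a b _ ha hb rfl
      exact h4 a b ha hb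
    · rintro i a _ hi ha rfl
      exact h5 i a hi ha

instance {n : ℕ} {f : (Fin n → M) → M} [DefF f] : DefP fun v => FormClosed (f v) :=
  DefP.congr inferInstance fun _ => formClosed_iff

instance {n : ℕ} {f : (Fin n → M) → M} [DefF f] : DefP fun v => IsForm (f v) := by
  unfold IsForm; infer_instance

theorem formClosed_V_om : FormClosed (V (om M)) := by
  have hnum : ∀ n : ℕ, (num n : M) ∈ₛ V (om M) := fun n => sub_V isOrd_om _ (num_mem_om n)
  have hom : om M ⊆ₛ V (om M) := sub_V isOrd_om
  have hp : ∀ {x y : M}, x ∈ₛ V (om M) → y ∈ₛ V (om M) → opair x y ∈ₛ V (om M) :=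
    isLim_om.opair_mem
  refine formClosed_iff.2 ⟨?_, ?_, ?_, ?_, ?_⟩
  · exact fun i j hi hj => hp (hnum 0) (hp (hom i hi) (hom j hj))
  · exact fun i j hi hj => hp (hnum 1) (hp (hom i hi) (hom j hj))
  · exact fun a ha => hp (hnum 2) ha
  · exact fun a b ha hb => hp (hnum 3) (hp ha hb)
  · exact fun i a hi ha => hp (hnum 4) (hp (hom i hi) ha)

theorem IsForm.mem_V_om {a : M} (ha : IsForm a) : a ∈ₛ V (om M) := ha _ formClosed_V_om

variable (M) in
/-- The set of codes of formulas. -/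
noncomputable def forms : M := cls IsForm

@[simp] theorem mem_forms {a : M} : a ∈ₛ forms M ↔ IsForm a :=
  mem_cls_of_sub (V (om M)) fun _ h => h.mem_V_om

theorem formClosed_forms : FormClosed (forms M) := by
  rw [formClosed_iff]
  simp only [mem_forms]
  refine ⟨?_, ?_, ?_, ?_, ?_⟩
  · exact fun i j hi hj S hS => (formClosed_iff.1 hS).1 i j hi hj
  · exact fun i j hi hj S hS => (formClosed_iff.1 hS).2.1 i j hi hj
  · exact fun a ha S hS => (formClosed_iff.1 hS).2.2.1 a (ha S hS)
  · exact fun a b ha hb S hS => (formClosed_iff.1 hS).2.2.2.1 a b (ha S hS) (hb S hS)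
  · exact fun i a hi ha S hS => (formClosed_iff.1 hS).2.2.2.2 i a hi (ha S hS)

theorem isForm_fEq {i j : M} (hi : i ∈ₛ om M) (hj : j ∈ₛ om M) : IsForm (fEq i j) :=
  mem_forms.1 ((formClosed_iff.1 formClosed_forms).1 i j hi hj)
theorem isForm_fMem {i j : M} (hi : i ∈ₛ om M) (hj : j ∈ₛ om M) : IsForm (fMem i j) :=
  mem_forms.1 ((formClosed_iff.1 formClosed_forms).2.1 i j hi hj)
theorem IsForm.fNeg {a : M} (ha : IsForm a) : IsForm (fNeg a) :=
  mem_forms.1 ((formClosed_iff.1 formClosed_forms).2.2.1 a (mem_forms.2 ha))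
theorem IsForm.fAnd {a b : M} (ha : IsForm a) (hb : IsForm b) : IsForm (fAnd a b) :=
  mem_forms.1 ((formClosed_iff.1 formClosed_forms).2.2.2.1 a b (mem_forms.2 ha) (mem_forms.2 hb))
theorem IsForm.fEx {i a : M} (hi : i ∈ₛ om M) (ha : IsForm a) : IsForm (fEx i a) :=
  mem_forms.1 ((formClosed_iff.1 formClosed_forms).2.2.2.2 i a hi (mem_forms.2 ha))

/-- Induction on formulas, for definable properties. -/
theorem IsForm.induction {P : M → Prop} [hP : Def₁ P]
    (eq : ∀ i j, i ∈ₛ om M → j ∈ₛ om M → P (ZFModel.fEq i j))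
    (mem : ∀ i j, i ∈ₛ om M → j ∈ₛ om M → P (ZFModel.fMem i j))
    (neg : ∀ a, IsForm a → P a → P (ZFModel.fNeg a))
    (and : ∀ a b, IsForm a → IsForm b → P a → P b → P (ZFModel.fAnd a b))
    (ex : ∀ i a, i ∈ₛ om M → IsForm a → P a → P (ZFModel.fEx i a)) {a : M} (ha : IsForm a) :
    P a := by
  have : FormClosed (sep (forms M) P) := by
    rw [formClosed_iff]
    simp only [mem_sep, mem_forms]
    exact ⟨fun i j hi hj => ⟨isForm_fEq hi hj, eq i j hi hj⟩,
      fun i j hi hj => ⟨isForm_fMem hi hj, mem i j hi hj⟩,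
      fun a h => ⟨h.1.fNeg, neg a h.1 h.2⟩,
      fun a b h h' => ⟨h.1.fAnd h'.1, and a b h.1 h'.1 h.2 h'.2⟩,
      fun i a hi h => ⟨h.1.fEx hi, ex i a hi h.1 h.2⟩⟩
  exact (mem_sep.1 (ha _ this)).2

end ZFModel

/-! ### Satisfaction -/

namespace ZFModel

variable {M : Type u} [setLang.Structure M] [hZF : ZF M]

/-- The set of assignments `ω → A`. -/
noncomputable def asg (A : M) : M := cls fun s => IsFun s (om M) A

instance {n : ℕ} {f : (Fin n → M) → M} [DefF f] : DefF fun v => asg (f v) := by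
  unfold asg; infer_instance

/-- The assignment `s[i := y]`. -/
noncomputable def upd (s i y : M) : M :=
  lam (om M) fun j => cls fun z => (j = i ∧ z ∈ₛ y) ∨ (¬ j = i ∧ z ∈ₛ val s j)

instance {n : ℕ} {f g h : (Fin n → M) → M} [DefF f] [DefF g] [DefF h] :
    DefF fun v => upd (f v) (g v) (h v) := by
  unfold upd; infer_instance

theorem IsFun.mem_prod_pow {f a b : M} (hf : IsFun f a b) : f ∈ₛ pow (prod a b) :=
  mem_pow.2 fun p hp => by
    obtain ⟨x, y, hx, hy, h⟩ := hf.1 p hp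
    exact mem_prod.2 ⟨x, y, hx, hy, isPair_iff.1 h⟩

@[simp] theorem mem_asg {A s : M} : s ∈ₛ asg A ↔ IsFun s (om M) A :=
  mem_cls_of_sub (pow (prod (om M) A)) fun _ h => h.mem_prod_pow

theorem isAssign_iff {s A : M} : IsAssign s A ↔ IsFun s (om M) A := by
  simp only [IsAssign, isOmega_iff]
  exact ⟨by rintro ⟨_, rfl, h⟩; exact h, fun h => ⟨_, rfl, h⟩⟩

theorem val_upd_self {s i y : M} (hi : i ∈ₛ om M) : val (upd s i y) i = y := by
  rw [upd, val_lam hi]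
  refine ext fun z => ?_
  rw [mem_cls_of_sub y] <;> simp

theorem val_upd_ne {s i j y : M} (hj : j ∈ₛ om M) (h : j ≠ i) : val (upd s i y) j = val s j := by
  rw [upd, val_lam hj]
  refine ext fun z => ?_
  rw [mem_cls_of_sub (val s j)] <;> simp [h]

theorem isFun_upd {s i y A : M} (hs : ∀ j, j ∈ₛ om M → j ≠ i → val s j ∈ₛ A) (hy : y ∈ₛ A) :
    IsFun (upd s i y) (om M) A := by
  refine isFun_lam fun j hj => ?_
  by_cases h : j = i
  · subst h
    have := val_upd_self (s := s) (y := y) hj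
    rw [upd, val_lam hj] at this
    rwa [this]
  · have := val_upd_ne (s := s) (y := y) hj h
    rw [upd, val_lam hj] at this
    rw [this]
    exact hs j hj h

theorem IsFun.upd {s i y A : M} (hs : IsFun s (om M) A) (hy : y ∈ₛ A) :
    IsFun (upd s i y) (om M) A :=
  isFun_upd (fun _ hj _ => hs.val_mem hj) hy

theorem agreeOff_iff {s s' i A : M} (hs : IsFun s (om M) A) (hs' : IsFun s' (om M) A) :
    AgreeOff i s s' ↔ ∀ j, j ∈ₛ om M → j ≠ i → val s j = val s' j := by
  constructor
  · intro h j hj hji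
    exact (hs'.app_iff.1 ((h j hji _).1 (hs.app_val hj))).2
  · intro h j hji x
    rw [hs.app_iff, hs'.app_iff]
    refine and_congr_right fun hj => ?_
    rw [h j hj hji]

theorem exists_agreeOff_iff {s i A : M} {P : M → Prop} (hs : IsFun s (om M) A) (hi : i ∈ₛ om M) :
    (∃ s', IsFun s' (om M) A ∧ AgreeOff i s s' ∧ P s') ↔ ∃ y, y ∈ₛ A ∧ P (upd s i y) := by
  constructor
  · rintro ⟨s', hs', h, hP⟩
    rw [agreeOff_iff hs hs'] at h
    refine ⟨_, hs'.val_mem hi, ?_⟩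
    have : ZFModel.upd s i (val s' i) = s' := by
      refine (hs.upd (hs'.val_mem hi)).ext hs' fun j hj => ?_
      by_cases hji : j = i
      · subst hji
        rw [val_upd_self hj]
      · rw [val_upd_ne hj hji, h j hj hji]
    rwa [this]
  · rintro ⟨y, hy, hP⟩
    refine ⟨_, hs.upd hy, ?_, hP⟩
    rw [agreeOff_iff hs (hs.upd hy)]
    exact fun j hj hji => (val_upd_ne hj hji).symm

/-- Tarski's clauses, written with set terms. -/
structure Tarski (T A : M) : Prop where
  eq : ∀ s i j, IsFun s (om M) A → i ∈ₛ om M → j ∈ₛ om M →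
    (App T (fEq i j) s ↔ val s i = val s j)
  mem : ∀ s i j, IsFun s (om M) A → i ∈ₛ om M → j ∈ₛ om M →
    (App T (fMem i j) s ↔ val s i ∈ₛ val s j)
  neg : ∀ s a, IsFun s (om M) A → IsForm a → (App T (fNeg a) s ↔ ¬ App T a s)
  and : ∀ s a b, IsFun s (om M) A → IsForm a → IsForm b →
    (App T (fAnd a b) s ↔ App T a s ∧ App T b s)
  ex : ∀ s i a, IsFun s (om M) A → i ∈ₛ om M → IsForm a →
    (App T (fEx i a) s ↔ ∃ y, y ∈ₛ A ∧ App T a (upd s i y))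

theorem isSatRel_iff {T A : M} : IsSatRel T A ↔ Tarski T A := by
  have e1 : ∀ {s i j : M}, IsFun s (om M) A → i ∈ₛ om M → j ∈ₛ om M →
      ((∃ x, App s i x ∧ App s j x) ↔ val s i = val s j) := by
    intro s i j hs hi hj
    simp only [hs.app_iff]
    exact ⟨by rintro ⟨_, ⟨-, rfl⟩, -, h⟩; exact h, fun h => ⟨_, ⟨hi, rfl⟩, hj, h⟩⟩
  have e2 : ∀ {s i j : M}, IsFun s (om M) A → i ∈ₛ om M → j ∈ₛ om M →
      ((∃ x y, App s i x ∧ App s j y ∧ x ∈ₛ y) ↔ val s i ∈ₛ val s j) := by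
    intro s i j hs hi hj
    simp only [hs.app_iff]
    exact ⟨by rintro ⟨_, _, ⟨-, rfl⟩, ⟨-, rfl⟩, h⟩; exact h,
      fun h => ⟨_, _, ⟨hi, rfl⟩, ⟨hj, rfl⟩, h⟩⟩
  simp only [IsSatRel, isOmega_iff, isAssign_iff, isTag_iff, isTag₂_iff]
  constructor
  · intro h
    refine ⟨fun s i j hs hi hj => ?_, fun s i j hs hi hj => ?_, fun s a hs ha => ?_,
      fun s a b hs ha hb => ?_, fun s i a hs hi ha => ?_⟩
    · rw [← e1 hs hi hj]
      exact (h _ s rfl hs).1 i j _ hi hj rfl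
    · rw [← e2 hs hi hj]
      exact (h _ s rfl hs).2.1 i j _ hi hj rfl
    · exact (h _ s rfl hs).2.2.1 a _ ha rfl
    · exact (h _ s rfl hs).2.2.2.1 a b _ ha hb rfl
    · rw [← exists_agreeOff_iff hs hi]
      exact (h _ s rfl hs).2.2.2.2 i a _ hi ha rfl
  · rintro h _ s rfl hs
    refine ⟨?_, ?_, ?_, ?_, ?_⟩
    · rintro i j _ hi hj rfl
      rw [e1 hs hi hj]
      exact h.eq s i j hs hi hj
    · rintro i j _ hi hj rfl
      rw [e2 hs hi hj]
      exact h.mem s i j hs hi hj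
    · rintro a _ ha rfl
      exact h.neg s a hs ha
    · rintro a b _ ha hb rfl
      exact h.and s a b hs ha hb
    · rintro i a _ hi ha rfl
      rw [exists_agreeOff_iff hs hi]
      exact h.ex s i a hs hi ha

/-! #### Existence of satisfaction relations -/

/-- `e = ⟨a, U⟩` follows in one step from the pairs in `G` by the clauses that compute the set `U`
of assignments satisfying `a`. -/
def SatStep (A G e : M) : Prop :=
  (∃ i j, i ∈ₛ om M ∧ j ∈ₛ om M ∧
    e = opair (fEq i j) (sep (asg A) fun s => val s i = val s j)) ∨
  (∃ i j, i ∈ₛ om M ∧ j ∈ₛ om M ∧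
    e = opair (fMem i j) (sep (asg A) fun s => val s i ∈ₛ val s j)) ∨
  (∃ a U, opair a U ∈ₛ G ∧ e = opair (fNeg a) (sep (asg A) fun s => ¬ s ∈ₛ U)) ∨
  (∃ a b U U', opair a U ∈ₛ G ∧ opair b U' ∈ₛ G ∧
    e = opair (fAnd a b) (sep (asg A) fun s => s ∈ₛ U ∧ s ∈ₛ U')) ∨
  (∃ i a U, i ∈ₛ om M ∧ opair a U ∈ₛ G ∧
    e = opair (fEx i a) (sep (asg A) fun s => ∃ y, y ∈ₛ A ∧ upd s i y ∈ₛ U))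

set_option synthInstance.maxHeartbeats 400000 in
set_option synthInstance.maxSize 2000 in
instance {n : ℕ} {f g h : (Fin n → M) → M} [DefF f] [DefF g] [DefF h] :
    DefP fun v => SatStep (f v) (g v) (h v) := by
  unfold SatStep; infer_instance

theorem SatStep.mono {A G G' e : M} (h : G ⊆ₛ G') (he : SatStep A G e) : SatStep A G' e := by
  rcases he with h1 | h1 | ⟨a, U, h1, h2⟩ | ⟨a, b, U, U', h1, h2, h3⟩ | ⟨i, a, U, h1, h2, h3⟩
  · exact .inl h1
  · exact .inr (.inl h1)
  · exact .inr (.inr (.inl ⟨a, U, h _ h1, h2⟩))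
  · exact .inr (.inr (.inr (.inl ⟨a, b, U, U', h _ h1, h _ h2, h3⟩)))
  · exact .inr (.inr (.inr (.inr ⟨i, a, U, h1, h _ h2, h3⟩)))

/-- The least set of pairs closed under `SatStep`: the graph of the map sending a formula to the
set of assignments satisfying it in `A`. -/
noncomputable def satGraph (A : M) : M :=
  sep (prod (forms M) (pow (asg A))) fun e => ∀ H, (∀ e, SatStep A H e → e ∈ₛ H) → e ∈ₛ H

theorem satGraph_closed {A e : M} (he : SatStep A (satGraph A) e) : e ∈ₛ satGraph A := by
  rw [satGraph, mem_sep]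
  constructor
  · have hsep : ∀ {P : M → Prop} [Def₁ P], sep (asg A) P ∈ₛ pow (asg A) :=
      mem_pow.2 fun z hz => (mem_sep.1 hz).1
    have hG : ∀ {a U : M}, opair a U ∈ₛ satGraph A → IsForm a := fun h =>
      mem_forms.1 (opair_mem_prod.1 (mem_sep.1 h).1).1
    rcases he with ⟨i, j, hi, hj, rfl⟩ | ⟨i, j, hi, hj, rfl⟩ | ⟨a, U, h1, rfl⟩ |
      ⟨a, b, U, U', h1, h2, rfl⟩ | ⟨i, a, U, hi, h2, rfl⟩
    · exact opair_mem_prod.2 ⟨mem_forms.2 (isForm_fEq hi hj), hsep⟩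
    · exact opair_mem_prod.2 ⟨mem_forms.2 (isForm_fMem hi hj), hsep⟩
    · exact opair_mem_prod.2 ⟨mem_forms.2 (hG h1).fNeg, hsep⟩
    · exact opair_mem_prod.2 ⟨mem_forms.2 ((hG h1).fAnd (hG h2)), hsep⟩
    · exact opair_mem_prod.2 ⟨mem_forms.2 ((hG h2).fEx hi), hsep⟩
  · intro H hH
    refine hH e (he.mono fun x hx => ?_)
    exact (mem_sep.1 hx).2 H hH

/-- By minimality, every element of `satGraph A` arises by a step from elements of `satGraph A`. -/
theorem satGraph_inv {A e : M} (he : e ∈ₛ satGraph A) : SatStep A (satGraph A) e := by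
  have := (mem_sep.1 he).2 (sep (satGraph A) fun e => SatStep A (satGraph A) e) fun e he => by
    have := he.mono (G' := satGraph A) fun x hx => (mem_sep.1 hx).1
    exact mem_sep.2 ⟨satGraph_closed this, this⟩
  exact (mem_sep.1 this).2

theorem satGraph_total {A a : M} (ha : IsForm a) : ∃ U, opair a U ∈ₛ satGraph A := by
  refine ha.induction (P := fun a => ∃ U, opair a U ∈ₛ satGraph A) ?_ ?_ ?_ ?_ ?_
  · exact fun i j hi hj => ⟨_, satGraph_closed (.inl ⟨i, j, hi, hj, rfl⟩)⟩
  · exact fun i j hi hj => ⟨_, satGraph_closed (.inr (.inl ⟨i, j, hi, hj, rfl⟩))⟩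
  · rintro a - ⟨U, h⟩
    exact ⟨_, satGraph_closed (.inr (.inr (.inl ⟨a, U, h, rfl⟩)))⟩
  · rintro a b - - ⟨U, h⟩ ⟨U', h'⟩
    exact ⟨_, satGraph_closed (.inr (.inr (.inr (.inl ⟨a, b, U, U', h, h', rfl⟩))))⟩
  · rintro i a hi - ⟨U, h⟩
    exact ⟨_, satGraph_closed (.inr (.inr (.inr (.inr ⟨i, a, U, hi, h, rfl⟩))))⟩

section inversion

variable {A i j a b U : M}

theorem satGraph_eq (h : opair (fEq i j) U ∈ₛ satGraph A) :
    U = sep (asg A) fun s => val s i = val s j := by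
  rcases satGraph_inv h with ⟨_, _, -, -, h⟩ | ⟨_, _, -, -, h⟩ | ⟨_, _, -, h⟩ |
    ⟨_, _, _, _, -, -, h⟩ | ⟨_, _, _, -, -, h⟩ <;> simp [fEq, fMem, fNeg, fAnd, fEx] at h
  obtain ⟨⟨rfl, rfl⟩, rfl⟩ := h
  rfl

theorem satGraph_mem (h : opair (fMem i j) U ∈ₛ satGraph A) :
    U = sep (asg A) fun s => val s i ∈ₛ val s j := by
  rcases satGraph_inv h with ⟨_, _, -, -, h⟩ | ⟨_, _, -, -, h⟩ | ⟨_, _, -, h⟩ |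
    ⟨_, _, _, _, -, -, h⟩ | ⟨_, _, _, -, -, h⟩ <;> simp [fEq, fMem, fNeg, fAnd, fEx] at h
  obtain ⟨⟨rfl, rfl⟩, rfl⟩ := h
  rfl

theorem satGraph_neg (h : opair (fNeg a) U ∈ₛ satGraph A) :
    ∃ U', opair a U' ∈ₛ satGraph A ∧ U = sep (asg A) fun s => ¬ s ∈ₛ U' := by
  rcases satGraph_inv h with ⟨_, _, -, -, h⟩ | ⟨_, _, -, -, h⟩ | ⟨_, U', h', h⟩ |
    ⟨_, _, _, _, -, -, h⟩ | ⟨_, _, _, -, -, h⟩ <;> simp [fEq, fMem, fNeg, fAnd, fEx] at h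
  obtain ⟨rfl, rfl⟩ := h
  exact ⟨U', h', rfl⟩

theorem satGraph_and (h : opair (fAnd a b) U ∈ₛ satGraph A) :
    ∃ U₁ U₂, opair a U₁ ∈ₛ satGraph A ∧ opair b U₂ ∈ₛ satGraph A ∧
      U = sep (asg A) fun s => s ∈ₛ U₁ ∧ s ∈ₛ U₂ := by
  rcases satGraph_inv h with ⟨_, _, -, -, h⟩ | ⟨_, _, -, -, h⟩ | ⟨_, _, -, h⟩ |
    ⟨_, _, U₁, U₂, h₁, h₂, h⟩ | ⟨_, _, _, -, -, h⟩ <;> simp [fEq, fMem, fNeg, fAnd, fEx] at h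
  obtain ⟨⟨rfl, rfl⟩, rfl⟩ := h
  exact ⟨U₁, U₂, h₁, h₂, rfl⟩

theorem satGraph_ex (h : opair (fEx i a) U ∈ₛ satGraph A) :
    ∃ U', opair a U' ∈ₛ satGraph A ∧
      U = sep (asg A) fun s => ∃ y, y ∈ₛ A ∧ upd s i y ∈ₛ U' := by
  rcases satGraph_inv h with ⟨_, _, -, -, h⟩ | ⟨_, _, -, -, h⟩ | ⟨_, _, -, h⟩ |
    ⟨_, _, _, _, -, -, h⟩ | ⟨_, _, U', -, h', h⟩ <;> simp [fEq, fMem, fNeg, fAnd, fEx] at h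
  obtain ⟨⟨rfl, rfl⟩, rfl⟩ := h
  exact ⟨U', h', rfl⟩

end inversion

/-- Uniqueness rests on the unique readability of formulas, which enters through the inversion
lemmas above. -/
theorem satGraph_unique {A a U U' : M} (ha : IsForm a) (h : opair a U ∈ₛ satGraph A)
    (h' : opair a U' ∈ₛ satGraph A) : U = U' := by
  refine ha.induction (P := fun a => ∀ U U', opair a U ∈ₛ satGraph A →
    opair a U' ∈ₛ satGraph A → U = U') ?_ ?_ ?_ ?_ ?_ U U' h h'
  · intro i j _ _ U U' h h'
    rw [satGraph_eq h, satGraph_eq h']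
  · intro i j _ _ U U' h h'
    rw [satGraph_mem h, satGraph_mem h']
  · intro a _ ih U U' h h'
    obtain ⟨W, hW, rfl⟩ := satGraph_neg h
    obtain ⟨W', hW', rfl⟩ := satGraph_neg h'
    rw [ih _ _ hW hW']
  · intro a b _ _ iha ihb U U' h h'
    obtain ⟨W₁, W₂, h₁, h₂, rfl⟩ := satGraph_and h
    obtain ⟨W₁', W₂', h₁', h₂', rfl⟩ := satGraph_and h'
    rw [iha _ _ h₁ h₁', ihb _ _ h₂ h₂']
  · intro i a _ _ ih U U' h h'
    obtain ⟨W, hW, rfl⟩ := satGraph_ex h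
    obtain ⟨W', hW', rfl⟩ := satGraph_ex h'
    rw [ih _ _ hW hW']

theorem exists_tarski (A : M) : ∃ T, Tarski T A := by
  let T := sep (prod (forms M) (asg A)) fun p =>
    ∃ a s U, p = opair a s ∧ opair a U ∈ₛ satGraph A ∧ s ∈ₛ U
  have hT : ∀ {a s : M}, IsForm a → IsFun s (om M) A →
      (App T a s ↔ ∃ U, opair a U ∈ₛ satGraph A ∧ s ∈ₛ U) := by
    intro a s ha hs
    rw [app_iff, mem_sep, opair_mem_prod]
    constructor
    · rintro ⟨-, a', s', U, h, hU, hsU⟩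
      obtain ⟨rfl, rfl⟩ := opair_inj.1 h
      exact ⟨U, hU, hsU⟩
    · rintro ⟨U, hU, hsU⟩
      exact ⟨⟨mem_forms.2 ha, mem_asg.2 hs⟩, a, s, U, rfl, hU, hsU⟩
  have hT' : ∀ {a s U : M}, IsForm a → IsFun s (om M) A → opair a U ∈ₛ satGraph A →
      (App T a s ↔ s ∈ₛ U) := by
    intro a s U ha hs hU
    rw [hT ha hs]
    exact ⟨by rintro ⟨U', hU', h⟩; exact satGraph_unique ha hU' hU ▸ h, fun h => ⟨U, hU, h⟩⟩
  refine ⟨T, ?_, ?_, ?_, ?_, ?_⟩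
  · intro s i j hs hi hj
    obtain ⟨U, hU⟩ := satGraph_total (A := A) (isForm_fEq hi hj)
    rw [hT' (isForm_fEq hi hj) hs hU, satGraph_eq hU, mem_sep, mem_asg]
    exact and_iff_right hs
  · intro s i j hs hi hj
    obtain ⟨U, hU⟩ := satGraph_total (A := A) (isForm_fMem hi hj)
    rw [hT' (isForm_fMem hi hj) hs hU, satGraph_mem hU, mem_sep, mem_asg]
    exact and_iff_right hs
  · intro s a hs ha
    obtain ⟨U, hU⟩ := satGraph_total (A := A) ha.fNeg
    obtain ⟨U', hU', e⟩ := satGraph_neg hU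
    rw [hT' ha.fNeg hs hU, hT' ha hs hU', e, mem_sep, mem_asg]
    exact and_iff_right hs
  · intro s a b hs ha hb
    obtain ⟨U, hU⟩ := satGraph_total (A := A) (ha.fAnd hb)
    obtain ⟨U₁, U₂, h₁, h₂, e⟩ := satGraph_and hU
    rw [hT' (ha.fAnd hb) hs hU, hT' ha hs h₁, hT' hb hs h₂, e, mem_sep, mem_asg]
    exact and_iff_right hs
  · intro s i a hs hi ha
    obtain ⟨U, hU⟩ := satGraph_total (A := A) (ha.fEx hi)
    obtain ⟨U', hU', e⟩ := satGraph_ex hU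
    rw [hT' (ha.fEx hi) hs hU, e, mem_sep, mem_asg, and_iff_right hs]
    refine exists_congr fun y => and_congr_right fun hy => ?_
    rw [hT' ha (hs.upd hy) hU']

/-! #### The Tarski-Vaught criterion -/

/-- The Tarski-Vaught criterion, for all formulas in the sense of `M`. -/
theorem Tarski.app_iff_of_sub {T T' W A : M} (hT : Tarski T W) (hT' : Tarski T' A) (hW : W ⊆ₛ A)
    (h : ∀ s i a, IsFun s (om M) W → i ∈ₛ om M → IsForm a →
      (∃ y, y ∈ₛ A ∧ App T' a (upd s i y)) → ∃ y, y ∈ₛ W ∧ App T' a (upd s i y))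
    {a s : M} (ha : IsForm a) (hs : IsFun s (om M) W) : App T a s ↔ App T' a s := by
  have up : ∀ {s : M}, IsFun s (om M) W → IsFun s (om M) A := by
    intro s hs
    rw [hs.eq_lam]
    exact isFun_lam fun x hx => hW _ (hs.val_mem hx)
  refine ha.induction (P := fun a => ∀ s, IsFun s (om M) W → (App T a s ↔ App T' a s))
    ?_ ?_ ?_ ?_ ?_ s hs
  · intro i j hi hj s hs
    rw [hT.eq s i j hs hi hj, hT'.eq s i j (up hs) hi hj]
  · intro i j hi hj s hs
    rw [hT.mem s i j hs hi hj, hT'.mem s i j (up hs) hi hj]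
  · intro a ha ih s hs
    rw [hT.neg s a hs ha, hT'.neg s a (up hs) ha, ih s hs]
  · intro a b ha hb iha ihb s hs
    rw [hT.and s a b hs ha hb, hT'.and s a b (up hs) ha hb, iha s hs, ihb s hs]
  · intro i a hi ha ih s hs
    rw [hT.ex s i a hs hi ha, hT'.ex s i a (up hs) hi ha]
    constructor
    · rintro ⟨y, hy, h'⟩
      exact ⟨y, hW y hy, (ih _ (hs.upd hy)).1 h'⟩
    · intro h'
      obtain ⟨y, hy, h'⟩ := h s i a hs hi ha h'
      exact ⟨y, hy, (ih _ (hs.upd hy)).2 h'⟩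

/-- By induction on formulas, that is, by the criterion with `W = A`, satisfaction does not depend on
the satisfaction relation. -/
theorem Tarski.sat_iff {T A a s : M} (hT : Tarski T A) (ha : IsForm a) (hs : IsFun s (om M) A) :
    Sat A a s ↔ App T a s := by
  constructor
  · rintro ⟨T', hT', h⟩
    exact ((isSatRel_iff.1 hT').app_iff_of_sub hT (Sub.refl A) (fun _ _ _ _ _ _ h => h) ha hs).1 h
  · intro h
    exact ⟨T, isSatRel_iff.2 hT, h⟩

theorem isElemSub_of {T W A : M} (hT : Tarski T A) (hne : ∃ x, x ∈ₛ W) (hW : W ⊆ₛ A)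
    (h : ∀ s i a, IsFun s (om M) W → i ∈ₛ om M → IsForm a →
      (∃ y, y ∈ₛ A ∧ App T a (upd s i y)) → ∃ y, y ∈ₛ W ∧ App T a (upd s i y)) :
    IsElemSub W A := by
  obtain ⟨T', hT'⟩ := exists_tarski W
  refine ⟨hne, hW, fun a s ha hs => ?_⟩
  rw [isAssign_iff] at hs
  have hs' : IsFun s (om M) A := by
    rw [hs.eq_lam]
    exact isFun_lam fun x hx => hW _ (hs.val_mem hx)
  rw [hT'.sat_iff ha hs, hT.sat_iff ha hs']
  exact hT'.app_iff_of_sub hT hW h ha hs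

/-- Satisfaction of a formula depends on finitely many values of the assignment only. -/
theorem Tarski.exists_support {T A a : M} (hT : Tarski T A) (ha : IsForm a) :
    ∃ n, n ∈ₛ om M ∧ ∀ s s', IsFun s (om M) A → IsFun s' (om M) A →
      (∀ j, j ∈ₛ n → val s j = val s' j) → (App T a s ↔ App T a s') := by
  have two : ∀ i j, i ∈ₛ om M → j ∈ₛ om M → ∃ n, n ∈ₛ om M ∧ i ⊆ₛ n ∧ j ⊆ₛ n := by
    intro i j hi hj
    rcases (isOrd_of_mem_om hi).sub_total (isOrd_of_mem_om hj) with h | h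
    · exact ⟨j, hj, h, Sub.refl _⟩
    · exact ⟨i, hi, Sub.refl _, h⟩
  refine ha.induction (P := fun a => ∃ n, n ∈ₛ om M ∧ ∀ s s', IsFun s (om M) A →
    IsFun s' (om M) A → (∀ j, j ∈ₛ n → val s j = val s' j) → (App T a s ↔ App T a s'))
    ?_ ?_ ?_ ?_ ?_
  · intro i j hi hj
    obtain ⟨n, hn, hin, hjn⟩ := two _ _ (succ_mem_om hi) (succ_mem_om hj)
    refine ⟨n, hn, fun s s' hs hs' h => ?_⟩
    rw [hT.eq s i j hs hi hj, hT.eq s' i j hs' hi hj, h i (hin i (mem_succ.2 (.inr rfl))),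
      h j (hjn j (mem_succ.2 (.inr rfl)))]
  · intro i j hi hj
    obtain ⟨n, hn, hin, hjn⟩ := two _ _ (succ_mem_om hi) (succ_mem_om hj)
    refine ⟨n, hn, fun s s' hs hs' h => ?_⟩
    rw [hT.mem s i j hs hi hj, hT.mem s' i j hs' hi hj, h i (hin i (mem_succ.2 (.inr rfl))),
      h j (hjn j (mem_succ.2 (.inr rfl)))]
  · rintro a ha ⟨n, hn, ih⟩
    refine ⟨n, hn, fun s s' hs hs' h => ?_⟩
    rw [hT.neg s a hs ha, hT.neg s' a hs' ha, ih s s' hs hs' h]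
  · rintro a b ha hb ⟨m, hm, iha⟩ ⟨n, hn, ihb⟩
    obtain ⟨k, hk, hmk, hnk⟩ := two _ _ hm hn
    refine ⟨k, hk, fun s s' hs hs' h => ?_⟩
    rw [hT.and s a b hs ha hb, hT.and s' a b hs' ha hb,
      iha s s' hs hs' fun j hj => h j (hmk j hj), ihb s s' hs hs' fun j hj => h j (hnk j hj)]
  · rintro i a hi ha ⟨n, hn, ih⟩
    refine ⟨n, hn, fun s s' hs hs' h => ?_⟩
    rw [hT.ex s i a hs hi ha, hT.ex s' i a hs' hi ha]
    refine exists_congr fun y => and_congr_right fun hy => ?_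
    refine ih _ _ (hs.upd hy) (hs'.upd hy) fun j hj => ?_
    have hjo := isOrd_om.mem_trans hj hn
    by_cases hji : j = i
    · subst hji
      rw [val_upd_self hjo, val_upd_self hjo]
    · rw [val_upd_ne hjo hji, val_upd_ne hjo hji, h j hj]

end ZFModel

/-! ### Elementary submodels and hulls -/

namespace ZFModel

/-- First-order formulas of set theory with variables `v₀, v₁, …`; they are coded inside a model
by `Fml.code`. -/
inductive Fml
  | eq (i j : ℕ)
  | mem (i j : ℕ)
  | neg (φ : Fml)
  | and (φ ψ : Fml)
  | ex (i : ℕ) (φ : Fml)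

/-- Only assignments that are eventually constant are sure to be represented in `M`. -/
def EvConst {α : Type*} (v : ℕ → α) : Prop := ∃ N d, ∀ n, N ≤ n → v n = d

theorem EvConst.update {α : Type*} {v : ℕ → α} (hv : EvConst v) (i : ℕ) (y : α) :
    EvConst (Function.update v i y) := by
  obtain ⟨N, d, h⟩ := hv
  refine ⟨max N (i + 1), d, fun n hn => ?_⟩
  rw [Function.update_of_ne (by omega), h n (by omega)]

variable {M : Type u} [setLang.Structure M]

/-- `(A, ∈) ⊨ φ[v]`, evaluated outside of `M`. -/
def Fml.Realize (A : M) : Fml → (ℕ → M) → Prop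
  | .eq i j, v => v i = v j
  | .mem i j, v => v i ∈ₛ v j
  | .neg φ, v => ¬ φ.Realize A v
  | .and φ ψ, v => φ.Realize A v ∧ ψ.Realize A v
  | .ex i φ, v => ∃ y, y ∈ₛ A ∧ φ.Realize A (Function.update v i y)

/-- Disjunction. -/
def Fml.or (φ ψ : Fml) : Fml := .neg (.and (.neg φ) (.neg ψ))
/-- Equivalence. -/
def Fml.iff (φ ψ : Fml) : Fml := .and (.neg (.and φ (.neg ψ))) (.neg (.and ψ (.neg φ)))
/-- Universal quantification. -/
def Fml.all (i : ℕ) (φ : Fml) : Fml := .neg (.ex i (.neg φ))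

/-- The formula `v_p = ⟨v_x, v_y⟩`; the variables `v₄` and `v₅` are bound in it. -/
def Fml.pair (p x y : ℕ) : Fml :=
  .all 4 (.iff (.mem 4 p) (.or (.all 5 (.iff (.mem 5 4) (.eq 5 x)))
    (.all 5 (.iff (.mem 5 4) (.or (.eq 5 x) (.eq 5 y))))))

section
variable {A : M} {φ ψ : Fml} {v : ℕ → M} {i j : ℕ}

@[simp] theorem Fml.realize_eq : (Fml.eq i j).Realize A v ↔ v i = v j := Iff.rfl
@[simp] theorem Fml.realize_mem : (Fml.mem i j).Realize A v ↔ v i ∈ₛ v j := Iff.rfl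
@[simp] theorem Fml.realize_neg : φ.neg.Realize A v ↔ ¬ φ.Realize A v := Iff.rfl
@[simp] theorem Fml.realize_and : (φ.and ψ).Realize A v ↔ φ.Realize A v ∧ ψ.Realize A v := Iff.rfl
@[simp] theorem Fml.realize_ex :
    (Fml.ex i φ).Realize A v ↔ ∃ y, y ∈ₛ A ∧ φ.Realize A (Function.update v i y) := Iff.rfl
@[simp] theorem Fml.realize_or : (φ.or ψ).Realize A v ↔ φ.Realize A v ∨ ψ.Realize A v := by
  simp [Fml.or, or_iff_not_imp_left]
@[simp] theorem Fml.realize_iff : (φ.iff ψ).Realize A v ↔ (φ.Realize A v ↔ ψ.Realize A v) := by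
  simp [Fml.iff, iff_iff_implies_and_implies]
@[simp] theorem Fml.realize_all :
    (Fml.all i φ).Realize A v ↔ ∀ y, y ∈ₛ A → φ.Realize A (Function.update v i y) := by
  simp [Fml.all]
end

variable [hZF : ZF M]

/-- The code of a formula in `M`. -/
noncomputable def Fml.code : Fml → M
  | .eq i j => fEq (num i) (num j)
  | .mem i j => fMem (num i) (num j)
  | .neg φ => fNeg φ.code
  | .and φ ψ => fAnd φ.code ψ.code
  | .ex i φ => fEx (num i) φ.code

theorem Fml.isForm_code : ∀ φ : Fml, IsForm (φ.code : M)
  | .eq i j => isForm_fEq (num_mem_om i) (num_mem_om j)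
  | .mem i j => isForm_fMem (num_mem_om i) (num_mem_om j)
  | .neg φ => φ.isForm_code.fNeg
  | .and φ ψ => φ.isForm_code.fAnd ψ.isForm_code
  | .ex i φ => φ.isForm_code.fEx (num_mem_om i)

/-- For the codes of actual formulas, satisfaction in the sense of `M` is satisfaction. -/
theorem Tarski.app_code_iff {T A : M} (hT : Tarski T A) (φ : Fml) {s : M} {v : ℕ → M}
    (hs : IsFun s (om M) A) (hv : ∀ n, val s (num n) = v n) :
    App T φ.code s ↔ φ.Realize A v := by
  induction φ generalizing s v with
  | eq i j => rw [Fml.code, hT.eq _ _ _ hs (num_mem_om i) (num_mem_om j), hv, hv]; rfl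
  | mem i j => rw [Fml.code, hT.mem _ _ _ hs (num_mem_om i) (num_mem_om j), hv, hv]; rfl
  | neg φ ih => rw [Fml.code, hT.neg _ _ hs φ.isForm_code, ih hs hv]; rfl
  | and φ ψ ihφ ihψ =>
    rw [Fml.code, hT.and _ _ _ hs φ.isForm_code ψ.isForm_code, ihφ hs hv, ihψ hs hv]; rfl
  | ex i φ ih =>
    rw [Fml.code, hT.ex _ _ _ hs (num_mem_om i) φ.isForm_code]
    refine exists_congr fun y => and_congr_right fun hy => ih (hs.upd hy) fun n => ?_
    by_cases h : n = i
    · subst h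
      rw [val_upd_self (num_mem_om n), Function.update_self]
    · rw [val_upd_ne (num_mem_om n) (fun e => h (num_inj.1 e)), hv, Function.update_of_ne h]

theorem EvConst.exists_assignment {v : ℕ → M} (hv : EvConst v) {A : M} (hA : ∀ n, v n ∈ₛ A) :
    ∃ s, IsFun s (om M) A ∧ ∀ n, val s (num n) = v n := by
  obtain ⟨N, d, h⟩ := hv
  have hd : d ∈ₛ A := h N le_rfl ▸ hA N
  have key : ∀ N, ∃ s, IsFun s (om M) A ∧ ∀ n, val s (num n) = if n < N then v n else d := by
    intro N
    induction N with
    | zero =>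
      refine ⟨lam (om M) fun _ => d, isFun_lam fun _ _ => hd, fun n => ?_⟩
      rw [val_lam (num_mem_om n)]
      simp
    | succ N ih =>
      obtain ⟨s, hs, hsv⟩ := ih
      refine ⟨upd s (num N) (v N), hs.upd (hA N), fun n => ?_⟩
      by_cases hn : n = N
      · subst hn
        rw [val_upd_self (num_mem_om n), if_pos (Nat.lt_succ_self n)]
      · rw [val_upd_ne (num_mem_om n) (fun e => hn (num_inj.1 e)), hsv]
        exact if_congr (by omega) rfl rfl
  obtain ⟨s, hs, hsv⟩ := key N
  refine ⟨s, hs, fun n => ?_⟩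
  rw [hsv]
  split_ifs with hn
  · rfl
  · exact (h n (by omega)).symm

theorem IsElemSub.realize_iff {X A : M} (h : IsElemSub X A) (φ : Fml) {v : ℕ → M}
    (hv : EvConst v) (hX : ∀ n, v n ∈ₛ X) : φ.Realize X v ↔ φ.Realize A v := by
  obtain ⟨s, hs, hsv⟩ := hv.exists_assignment hX
  have hs' : IsFun s (om M) A := by
    rw [hs.eq_lam]
    exact isFun_lam fun x hx => h.2.1 _ (hs.val_mem hx)
  obtain ⟨T, hT⟩ := exists_tarski X
  obtain ⟨T', hT'⟩ := exists_tarski A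
  rw [← hT.app_code_iff φ hs hsv, ← hT'.app_code_iff φ hs' hsv,
    ← hT.sat_iff φ.isForm_code hs, ← hT'.sat_iff φ.isForm_code hs']
  exact h.2.2 _ _ φ.isForm_code (isAssign_iff.2 hs)

/-- The assignment `v₀ = a`, `vₙ = b` for `n > 0`. -/
def vec₂ (a b : M) : ℕ → M
  | 0 => a
  | _ + 1 => b

theorem IsElemSub.exists_mem {X A a b : M} (h : IsElemSub X A) (φ : Fml) (i : ℕ)
    (ha : a ∈ₛ X) (hb : b ∈ₛ X)
    (hex : ∃ y, y ∈ₛ A ∧ φ.Realize A (Function.update (vec₂ a b) i y)) :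
    ∃ y, y ∈ₛ X ∧ φ.Realize A (Function.update (vec₂ a b) i y) := by
  have hv : EvConst (vec₂ a b) := ⟨1, b, fun n hn => by
    cases n with
    | zero => omega
    | succ n => rfl⟩
  have hX : ∀ n, vec₂ a b n ∈ₛ X := fun n => by
    cases n with
    | zero => exact ha
    | succ n => exact hb
  obtain ⟨y, hy, hφ⟩ := (h.realize_iff (.ex i φ) hv hX).2 hex
  refine ⟨y, hy, (h.realize_iff φ (hv.update i y) fun n => ?_).1 hφ⟩
  by_cases hn : n = i
  · subst hn
    rwa [Function.update_self]
  · rw [Function.update_of_ne hn]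
    exact hX n

theorem Fml.realize_pair {b : M} (hb : IsLim b) {p x y : ℕ} {v : ℕ → M} (hp : p < 4 ∨ 5 < p)
    (hx : x < 4 ∨ 5 < x) (hy : y < 4 ∨ 5 < y)
    (hpb : v p ∈ₛ V b) (hxb : v x ∈ₛ V b) (hyb : v y ∈ₛ V b) :
    (Fml.pair p x y).Realize (V b) v ↔ v p = opair (v x) (v y) := by
  have ht := isTrans_V hb.isOrd
  have hp4 : p ≠ 4 := by omega
  have hx4 : x ≠ 4 := by omega
  have hx5 : x ≠ 5 := by omega
  have hy4 : y ≠ 4 := by omega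
  have hy5 : y ≠ 5 := by omega
  have e : ∀ z a c : M, z ∈ₛ V b → a ∈ₛ V b → c ∈ₛ V b →
      ((∀ t, t ∈ₛ V b → (t ∈ₛ z ↔ t = a ∨ t = c)) ↔ z = upair a c) := by
    intro z a c hz ha hc
    constructor
    · intro h
      refine ext fun t => ?_
      rw [mem_upair]
      constructor
      · exact fun htz => (h t (ht z hz t htz)).1 htz
      · rintro (rfl | rfl)
        · exact (h t ha).2 (.inl rfl)
        · exact (h t hc).2 (.inr rfl)
    · rintro rfl t -
      exact mem_upair
  have e' : ∀ z a : M, z ∈ₛ V b → a ∈ₛ V b →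
      ((∀ t, t ∈ₛ V b → (t ∈ₛ z ↔ t = a)) ↔ z = upair a a) := by
    intro z a hz ha
    rw [← e z a a hz ha ha]
    simp
  simp only [Fml.pair, realize_all, realize_iff, realize_or, realize_mem, realize_eq,
    Function.update_self, Function.update_of_ne hp4, Function.update_of_ne hx5,
    Function.update_of_ne hx4, Function.update_of_ne hy5, Function.update_of_ne hy4,
    Function.update_of_ne (show (4 : ℕ) ≠ 5 by decide)]
  constructor
  · intro h
    refine ext fun z => ?_
    rw [opair, mem_upair]
    constructor
    · intro hz
      have hzb := ht _ hpb z hz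
      have := (h z hzb).1 hz
      rwa [e' z _ hzb hxb, e z _ _ hzb hxb hyb] at this
    · intro hz
      have hzb : z ∈ₛ V b := by
        rcases hz with rfl | rfl
        · exact hb.upair_mem hxb hxb
        · exact hb.upair_mem hxb hyb
      refine (h z hzb).2 ?_
      rwa [e' z _ hzb hxb, e z _ _ hzb hxb hyb]
  · intro h z hzb
    rw [e' z _ hzb hxb, e z _ _ hzb hxb hyb, h, opair, mem_upair]

/-- `Z` is closed under pairing and unpairing, and for every relation `q` in `Z` it contains a
`q`-successor of each of its elements that has one. These are the only consequences of elementarity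
in a limit level of the hierarchy that are needed, and they pass to suitable unions. -/
structure IsHull (Z : M) : Prop where
  opair_mem : ∀ a b, a ∈ₛ Z → b ∈ₛ Z → opair a b ∈ₛ Z
  fst_mem : ∀ a b, opair a b ∈ₛ Z → a ∈ₛ Z
  snd_mem : ∀ a b, opair a b ∈ₛ Z → b ∈ₛ Z
  app : ∀ q u z, q ∈ₛ Z → u ∈ₛ Z → App q u z → ∃ z', z' ∈ₛ Z ∧ App q u z'

theorem IsHull.val_mem {Z f a b x : M} (hZ : IsHull Z) (hf : IsFun f a b) (hfZ : f ∈ₛ Z)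
    (hx : x ∈ₛ a) (hxZ : x ∈ₛ Z) : val f x ∈ₛ Z := by
  obtain ⟨y, hy, h⟩ := hZ.app f x _ hfZ hxZ (hf.app_val hx)
  rwa [← (hf.app_iff.1 h).2]

/-- `Z` satisfies the axiom of extensionality. -/
def IsExtensional (Z : M) : Prop :=
  ∀ x y, x ∈ₛ Z → y ∈ₛ Z → (∀ z, z ∈ₛ Z → (z ∈ₛ x ↔ z ∈ₛ y)) → x = y

theorem IsElemSub.isExtensional {Z A : M} (h : IsElemSub Z A) (hA : IsTrans A) :
    IsExtensional Z := by
  intro x y hx hy hxy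
  by_contra hne
  have : ∃ z, z ∈ₛ A ∧ (Fml.neg (.iff (.mem 3 0) (.mem 3 1))).Realize A
      (Function.update (vec₂ x y) 3 z) := by
    by_contra hno
    refine hne (ext fun z => ?_)
    by_cases hz : z ∈ₛ A
    · by_contra hz'
      exact hno ⟨z, hz, by simpa [vec₂] using hz'⟩
    · exact ⟨fun h' => absurd (hA x (h.2.1 x hx) z h') hz,
        fun h' => absurd (hA y (h.2.1 y hy) z h') hz⟩
  obtain ⟨z, hz, h'⟩ := h.exists_mem _ 3 hx hy this
  exact absurd (hxy z hz) (by simpa [vec₂] using h')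

/-- In the formulas used here, `v₀` and `v₁` stand for parameters, `v₃` for the element to be found and
`v₆` for an auxiliary one. -/
theorem IsElemSub.isHull {Z b : M} (hb : IsLim b) (h : IsElemSub Z (V b)) : IsHull Z := by
  have ht := isTrans_V hb.isOrd
  have hZ := h.2.1
  refine ⟨fun x y hx hy => ?_, fun x y hp => ?_, fun x y hp => ?_, fun q u z hq hu hz => ?_⟩
  · have key : ∀ z, z ∈ₛ V b → ((Fml.pair 3 0 1).Realize (V b)
        (Function.update (vec₂ x y) 3 z) ↔ z = opair x y) := fun z hz =>
      Fml.realize_pair hb (by decide) (by decide) (by decide) hz (hZ x hx) (hZ y hy)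
    have hxy := hb.opair_mem (hZ x hx) (hZ y hy)
    obtain ⟨z, hz, hz'⟩ := h.exists_mem (.pair 3 0 1) 3 hx hy ⟨_, hxy, (key _ hxy).2 rfl⟩
    rwa [← (key z (hZ z hz)).1 hz']
  · have hxb := fst_mem_of_opair_mem ht (hZ _ hp)
    have hyb := snd_mem_of_opair_mem ht (hZ _ hp)
    have key : ∀ z, z ∈ₛ V b → ((Fml.ex 6 (.pair 0 3 6)).Realize (V b)
        (Function.update (vec₂ (opair x y) (opair x y)) 3 z) ↔
          ∃ w, w ∈ₛ V b ∧ opair x y = opair z w) := fun z hz =>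
      exists_congr fun w => and_congr_right fun hw =>
        Fml.realize_pair hb (by decide) (by decide) (by decide) (hZ _ hp) hz hw
    obtain ⟨z, hz, hz'⟩ := h.exists_mem (.ex 6 (.pair 0 3 6)) 3 hp hp
      ⟨x, hxb, (key _ hxb).2 ⟨y, hyb, rfl⟩⟩
    obtain ⟨w, -, e⟩ := (key z (hZ z hz)).1 hz'
    rwa [(opair_inj.1 e).1]
  · have hxb := fst_mem_of_opair_mem ht (hZ _ hp)
    have hyb := snd_mem_of_opair_mem ht (hZ _ hp)
    have key : ∀ z, z ∈ₛ V b → ((Fml.ex 6 (.pair 0 6 3)).Realize (V b)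
        (Function.update (vec₂ (opair x y) (opair x y)) 3 z) ↔
          ∃ w, w ∈ₛ V b ∧ opair x y = opair w z) := fun z hz =>
      exists_congr fun w => and_congr_right fun hw =>
        Fml.realize_pair hb (by decide) (by decide) (by decide) (hZ _ hp) hw hz
    obtain ⟨z, hz, hz'⟩ := h.exists_mem (.ex 6 (.pair 0 6 3)) 3 hp hp
      ⟨y, hyb, (key _ hyb).2 ⟨x, hxb, rfl⟩⟩
    obtain ⟨w, -, e⟩ := (key z (hZ z hz)).1 hz'
    rwa [(opair_inj.1 e).2]
  · have key : ∀ z, z ∈ₛ V b → ((Fml.ex 6 (.and (.mem 6 0) (.pair 6 1 3))).Realize (V b)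
        (Function.update (vec₂ q u) 3 z) ↔ ∃ w, w ∈ₛ V b ∧ w ∈ₛ q ∧ w = opair u z) := fun z hz =>
      exists_congr fun w => and_congr_right fun hw => and_congr_right fun _ =>
        Fml.realize_pair hb (by decide) (by decide) (by decide) hw (hZ u hu) hz
    rw [app_iff] at hz
    have hp := ht q (hZ q hq) _ hz
    have hzb := snd_mem_of_opair_mem ht hp
    obtain ⟨y, hy, hy'⟩ := h.exists_mem (.ex 6 (.and (.mem 6 0) (.pair 6 1 3))) 3 hq hu
      ⟨z, hzb, (key z hzb).2 ⟨_, hp, hz, rfl⟩⟩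
    obtain ⟨w, -, hw, rfl⟩ := (key y (hZ y hy)).1 hy'
    exact ⟨y, hy, app_iff.2 hw⟩

end ZFModel

/-! ### Weakly Löwenheim–Skolem cardinals -/

namespace ZFModel

variable {M : Type u} [setLang.Structure M]

theorem Def₂.comp {n : ℕ} {R : M → M → Prop} (hR : Def₂ R) (f g : (Fin n → M) → M) [hf : DefF f]
    [hg : DefF g] : DefP fun v => R (f v) (g v) :=
  DefP.comp hR ![f, g] (by intro i; fin_cases i <;> assumption)

theorem IsWeaklyLS.isOrd {κ : M} (hκ : IsWeaklyLS κ) : IsOrd κ := hκ.1.1.1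

variable [hZF : ZF M]

/-- A definable partial map from `D` onto the nonempty set `Z` extends to a surjection that is a
set of `M`. -/
theorem exists_isSurj {D Z z₀ : M} (R : M → M → Prop) [hR : Def₂ R] (hz₀ : z₀ ∈ₛ Z)
    (huniq : ∀ w z z', w ∈ₛ D → z ∈ₛ Z → z' ∈ₛ Z → R w z → R w z' → z = z')
    (honto : ∀ z, z ∈ₛ Z → ∃ w, w ∈ₛ D ∧ R w z) : ∃ f, IsSurj f D Z := by
  have hR' {n : ℕ} (f g : (Fin n → M) → M) [DefF f] [DefF g] : DefP fun v => R (f v) (g v) :=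
    Def₂.comp hR f g
  let F : M → M := fun w => cls fun t =>
    (∃ z, z ∈ₛ Z ∧ R w z ∧ t ∈ₛ z) ∨ ((¬ ∃ z, z ∈ₛ Z ∧ R w z) ∧ t ∈ₛ z₀)
  have hF : DefF₁ F := by unfold F; infer_instance
  have h1 : ∀ w z, w ∈ₛ D → z ∈ₛ Z → R w z → F w = z := by
    intro w z hw hz h
    have e : ∀ t, ((∃ z, z ∈ₛ Z ∧ R w z ∧ t ∈ₛ z) ∨ ((¬ ∃ z, z ∈ₛ Z ∧ R w z) ∧ t ∈ₛ z₀)) ↔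
        t ∈ₛ z := by
      intro t
      constructor
      · rintro (⟨z', hz', h', ht⟩ | ⟨h', -⟩)
        · exact huniq w z z' hw hz hz' h h' ▸ ht
        · exact absurd ⟨z, hz, h⟩ h'
      · exact fun ht => .inl ⟨z, hz, h, ht⟩
    exact ext fun t => (mem_cls_of_sub z fun t ht => (e t).1 ht).trans (e t)
  have h2 : ∀ w, (¬ ∃ z, z ∈ₛ Z ∧ R w z) → F w = z₀ := by
    intro w h
    have e : ∀ t, ((∃ z, z ∈ₛ Z ∧ R w z ∧ t ∈ₛ z) ∨ ((¬ ∃ z, z ∈ₛ Z ∧ R w z) ∧ t ∈ₛ z₀)) ↔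
        t ∈ₛ z₀ := by
      intro t
      constructor
      · rintro (⟨z', hz', h', -⟩ | ⟨-, ht⟩)
        · exact absurd ⟨z', hz', h'⟩ h
        · exact ht
      · exact fun ht => .inr ⟨h, ht⟩
    exact ext fun t => (mem_cls_of_sub z₀ fun t ht => (e t).1 ht).trans (e t)
  refine ⟨lam D F, isSurj_lam (fun w hw => ?_) fun z hz => ?_⟩
  · by_cases h : ∃ z, z ∈ₛ Z ∧ R w z
    · obtain ⟨z, hz, h⟩ := h
      rwa [h1 w z hw hz h]
    · rwa [h2 w h]
  · obtain ⟨w, hw, h⟩ := honto z hz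
    exact ⟨w, hw, (h1 w z hw hz h).symm⟩

/-! #### Transitive collapses -/

theorem mem_val_collapse_iff {p c X : M} (hp : IsSurj p X c)
    (h : ∀ x v, x ∈ₛ X → App p x v → ∀ z, z ∈ₛ v ↔ ∃ y, y ∈ₛ X ∧ y ∈ₛ x ∧ App p y z)
    {x z : M} (hx : x ∈ₛ X) : z ∈ₛ val p x ↔ ∃ y, y ∈ₛ X ∧ y ∈ₛ x ∧ z = val p y := by
  rw [h x _ hx (hp.1.app_val hx)]
  refine exists_congr fun y => and_congr_right fun hy => and_congr_right fun _ => ?_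
  rw [hp.1.app_iff]
  exact and_iff_right hy

/-- The collapsing map of an extensional set is injective. -/
theorem collapse_injective {p X : M} (hX : IsExtensional X)
    (h : ∀ x z, x ∈ₛ X → (z ∈ₛ val p x ↔ ∃ y, y ∈ₛ X ∧ y ∈ₛ x ∧ z = val p y))
    {x x' : M} (hx : x ∈ₛ X) (hx' : x' ∈ₛ X) (e : val p x = val p x') : x = x' := by
  by_contra hne
  obtain ⟨m, hm, hmin⟩ := hZF.model.foundation
    (sep X fun x => ∃ x', x' ∈ₛ X ∧ val p x = val p x' ∧ x ≠ x')
    ⟨x, mem_sep.2 ⟨hx, x', hx', e, hne⟩⟩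
  obtain ⟨hm, m', hm', e, hne⟩ := mem_sep.1 hm
  have inj : ∀ y y', y ∈ₛ X → y ∈ₛ m → y' ∈ₛ X → val p y = val p y' → y = y' := by
    intro y y' hy hym hy' e
    by_contra hne
    exact hmin y (mem_sep.2 ⟨hy, y', hy', e, hne⟩) hym
  refine hne (hX m m' hm hm' fun z hz => ⟨fun hzm => ?_, fun hzm => ?_⟩)
  · have : val p z ∈ₛ val p m' := e ▸ (h m _ hm).2 ⟨z, hz, hzm, rfl⟩
    obtain ⟨y, hy, hym, e'⟩ := (h m' _ hm').1 this
    exact inj z y hz hzm hy e' ▸ hym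
  · have : val p z ∈ₛ val p m := e ▸ (h m' _ hm').2 ⟨z, hz, hzm, rfl⟩
    obtain ⟨y, hy, hym, e'⟩ := (h m _ hm).1 this
    exact inj y z hy hym hz e'.symm ▸ hym

section WeaklyLS

variable {κ : M}

/-- The form in which the weak Löwenheim–Skolem property is used: every set `x` lies in a hull
`Z ⊇ V_g` that is a surjective image of some `V_d` with `d < κ`, and that does not include `κ`. -/
theorem IsWeaklyLS.exists_isHull (hκ : IsWeaklyLS κ) {g : M} (hg : g ∈ₛ κ) (x : M) :
    ∃ Z, IsHull Z ∧ V g ⊆ₛ Z ∧ x ∈ₛ Z ∧ ¬ κ ⊆ₛ Z ∧ ∃ d f, d ∈ₛ κ ∧ IsSurj f (V d) Z := by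
  have hκo := hκ.isOrd
  obtain ⟨b, hb, hκb, hxb⟩ := exists_isLim_mem_V x hκo
  obtain ⟨Z, hZ, hgZ, hxZ, c, ⟨p, hp, hpc⟩, hc⟩ := hκ.2 g b (V g) (V b) (V κ) x hg hb.isOrd
    (hb.isOrd.sub hκb) (isV_iff.2 ⟨hκo.mem hg, rfl⟩) (isV_iff.2 ⟨hb.isOrd, rfl⟩)
    (isV_iff.2 ⟨hκo, rfl⟩) hxb
  have hval : ∀ x z, x ∈ₛ Z → (z ∈ₛ val p x ↔ ∃ y, y ∈ₛ Z ∧ y ∈ₛ x ∧ z = val p y) :=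
    fun x z hx => mem_val_collapse_iff hp hpc hx
  refine ⟨Z, hZ.isHull hb, hgZ, hxZ, fun hκZ => ?_, ?_⟩
  · -- the collapsing map is the identity on `κ`, so that `κ ⊆ c ∈ V_κ`
    have hid : ∀ ξ, IsOrd ξ → ξ ∈ₛ κ → val p ξ = ξ := fun ξ hξ => by
      refine hξ.induction (P := fun ξ => ξ ∈ₛ κ → val p ξ = ξ) fun ξ _ ih hξκ => ?_
      refine ext fun z => ?_
      rw [hval ξ z (hκZ ξ hξκ)]
      constructor
      · rintro ⟨y, -, hy, rfl⟩
        rwa [ih y hy (hκo.mem_trans hy hξκ)]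
      · intro hz
        have := hκo.mem_trans hz hξκ
        exact ⟨z, hκZ z this, hz, (ih z hz this).symm⟩
    have : κ ⊆ₛ c := fun ξ hξ => hid ξ (hκo.mem hξ) hξ ▸ hp.1.val_mem (hκZ ξ hξ)
    exact mem_irrefl κ (mem_of_mem_V hκo hκo (mem_V_of_sub hκo hc this))
  · obtain ⟨d, hd, hcd⟩ := (mem_V hκo).1 hc
    obtain ⟨f, hf⟩ := exists_isSurj (D := V d) (fun w z => w = val p z) hxZ
      (fun w z z' _ hz hz' e e' => collapse_injective (hZ.isExtensional (isTrans_V hb.isOrd)) hval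
        hz hz' (e.symm.trans e'))
      (fun z hz => ⟨_, hcd _ (hp.1.val_mem hz), rfl⟩)
    exact ⟨d, f, hd, hf⟩

theorem IsWeaklyLS.om_mem (hκ : IsWeaklyLS κ) : om M ∈ₛ κ := by
  obtain ⟨w, hw, h⟩ := hκ.1.2
  rwa [← isOmega_iff.1 hw]

theorem IsWeaklyLS.isLim (hκ : IsWeaklyLS κ) : IsLim κ := by
  have hκo := hκ.isOrd
  refine ⟨hκo, hκo.mem_trans emp_mem_om hκ.om_mem, fun b hb => ?_⟩
  have hbo := hκo.mem hb
  rcases hbo.isOrd_succ.trichotomy hκo with h | h | h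
  · exact h
  · exfalso
    obtain ⟨Z, -, hbZ, hb', hκZ, -⟩ := hκ.exists_isHull hb b
    refine hκZ fun z hz => ?_
    rw [← h, mem_succ] at hz
    rcases hz with hz | rfl
    · exact hbZ z (sub_V hbo z hz)
    · exact hb'
  · rcases mem_succ.1 h with h | rfl
    · exact absurd hb (mem_asymm h)
    · exact absurd hb (mem_irrefl _)

theorem IsWeaklyLS.not_isSurj (hκ : IsWeaklyLS κ) {d : M} (hd : d ∈ₛ κ) :
    ¬ ∃ f, IsSurj f (V d) κ := by
  rintro ⟨f, hf⟩
  obtain ⟨Z, hZ, hdZ, hfZ, hκZ, -⟩ := hκ.exists_isHull hd f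
  refine hκZ fun z hz => ?_
  obtain ⟨w, hw, rfl⟩ := hf.exists_val hz
  exact hZ.val_mem hf.1 hfZ hw (hdZ w hw)

end WeaklyLS

/-! #### There is no surjection from `V_κ` onto `κ⁺` -/

/-- `z` lies in the image of `V_d` under `g`. -/
def InImg (g d z : M) : Prop := ∃ w, w ∈ₛ V d ∧ App g w z

/-- Given the values of `f`, the next element of the enumeration of the range of `g` is `ξ`: it is
the least new element of the image of `V_d`, for the least `d < κ` such that there is one. -/
def IsNext (κ g f ξ : M) : Prop :=
  ∃ d, d ∈ₛ κ ∧ InImg g d ξ ∧ (¬ ∃ c, App f c ξ) ∧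
    (∀ d' z, d' ∈ₛ d → InImg g d' z → ∃ c, App f c z) ∧
    ∀ z, z ∈ₛ ξ → InImg g d z → ∃ c, App f c z

instance {n : ℕ} {f g h : (Fin n → M) → M} [DefF f] [DefF g] [DefF h] :
    DefP fun v => InImg (f v) (g v) (h v) := by
  unfold InImg; infer_instance

instance {n : ℕ} {f g h k : (Fin n → M) → M} [DefF f] [DefF g] [DefF h] [DefF k] :
    DefP fun v => IsNext (f v) (g v) (h v) (k v) := by
  unfold IsNext; infer_instance

/-- The enumeration, without repetitions, of the range of `g` that lists the image of `V_d` before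
the rest of the range, for every `d < κ`. -/
noncomputable def enum (κ g : M) : M → M :=
  recOrd fun f => cls fun z => ∃ ξ, IsNext κ g f ξ ∧ z ∈ₛ ξ

instance {κ g : M} {n : ℕ} {f : (Fin n → M) → M} [DefF f] : DefF fun v => enum κ g (f v) := by
  unfold enum; infer_instance

theorem IsNext.unique {κ l g f ξ ξ' : M} (hκ : IsOrd κ) (hl : IsOrd l) (hg : IsFun g (V κ) l)
    (h : IsNext κ g f ξ) (h' : IsNext κ g f ξ') : ξ = ξ' := by
  obtain ⟨d, hd, hi, hn, h1, h2⟩ := h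
  obtain ⟨d', hd', hi', hn', h1', h2'⟩ := h'
  have ho : ∀ {d ξ}, InImg g d ξ → IsOrd ξ := by
    rintro d ξ ⟨w, -, hw⟩
    exact hl.mem (hg.mem hw).2
  rcases (hκ.mem hd).trichotomy (hκ.mem hd') with h | rfl | h
  · exact absurd (h1' d ξ h hi) hn
  · rcases (ho hi).trichotomy (ho hi') with h | h | h
    · exact absurd (h2' ξ h hi) hn
    · exact h
    · exact absurd (h2 ξ' h hi') hn'
  · exact absurd (h1 d' ξ' h hi') hn'

theorem InImg.mono {g d d' z : M} (hd : IsOrd d) (hd' : IsOrd d') (h : d ⊆ₛ d')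
    (hz : InImg g d z) : InImg g d' z := by
  obtain ⟨w, hw, hz⟩ := hz
  exact ⟨w, V_mono hd hd' h w hw, hz⟩

theorem enum_isNext {κ l g η ζ : M} (hκ : IsLim κ) (hl : IsOrd l) (hg : IsSurj g (V κ) l)
    (hη : IsOrd η) (hζ : ζ ∈ₛ l) (hζη : ∀ c, c ∈ₛ η → ζ ≠ enum κ g c) :
    IsNext κ g (lam η (enum κ g)) (enum κ g η) := by
  have happ : ∀ z, (∃ c, App (lam η (enum κ g)) c z) ↔ ∃ c, c ∈ₛ η ∧ z = enum κ g c :=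
    fun z => exists_congr fun c => app_lam
  have ex : ∃ ξ, IsNext κ g (lam η (enum κ g)) ξ := by
    obtain ⟨w, hw, hwζ⟩ := hg.2 ζ hζ
    obtain ⟨b, hb, hwb⟩ := (mem_V hκ.isOrd).1 hw
    have hζi : InImg g (succ b) ζ := ⟨w, (mem_V_succ (hκ.isOrd.mem hb)).2 hwb, hwζ⟩
    obtain ⟨d, hd, ⟨hdκ, ζ', hζ', hζ'η⟩, hmin, -⟩ :=
      (hκ.isOrd.mem (hκ.succ_mem b hb)).exists_least
        (P := fun d => d ∈ₛ κ ∧ ∃ z, InImg g d z ∧ ¬ ∃ c, App (lam η (enum κ g)) c z)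
        ⟨hκ.succ_mem b hb, ζ, hζi, by
          rw [happ]
          rintro ⟨c, hc, e⟩
          exact hζη c hc e⟩
    have hζ'l : IsOrd ζ' := by
      obtain ⟨w, -, hw⟩ := hζ'
      exact hl.mem (hg.1.mem hw).2
    obtain ⟨ξ, hξ, ⟨hξi, hξη⟩, hξmin, -⟩ := hζ'l.exists_least
      (P := fun z => InImg g d z ∧ ¬ ∃ c, App (lam η (enum κ g)) c z) ⟨hζ', hζ'η⟩
    refine ⟨ξ, d, hdκ, hξi, hξη, fun d' z hd' hz => ?_, fun z hz hzi => ?_⟩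
    · by_contra hno
      exact hmin d' hd' ⟨hκ.isOrd.mem_trans hd' hdκ, z, hz, hno⟩
    · by_contra hno
      exact hξmin z hz ⟨hzi, hno⟩
  obtain ⟨ξ, hξ⟩ := ex
  have : enum κ g η = ξ := by
    refine ext fun z => ?_
    conv_lhs => rw [enum, recOrd_eq hη]
    change (z ∈ₛ cls fun z => ∃ ξ, IsNext κ g (lam η (enum κ g)) ξ ∧ z ∈ₛ ξ) ↔ _
    rw [mem_cls_of_sub ξ]
    · constructor
      · rintro ⟨ξ', h', hz⟩
        exact h'.unique hκ.isOrd hl hg.1 hξ ▸ hz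
      · exact fun hz => ⟨ξ, hξ, hz⟩
    · rintro z ⟨ξ', h', hz⟩
      exact h'.unique hκ.isOrd hl hg.1 hξ ▸ hz
  rwa [this]

/-- If no `V_d` with `d < κ` maps onto `κ`, then `V_κ` does not map onto a cardinal above `κ`. -/
theorem not_isSurj_of_card {κ l : M} (hκ : IsLim κ) (h : ∀ d, d ∈ₛ κ → ¬ ∃ f, IsSurj f (V d) κ)
    (hl : IsCard l) (hκl : κ ∈ₛ l) : ¬ ∃ g, IsSurj g (V κ) l := by
  rintro ⟨g, hg⟩
  have hκo := hκ.isOrd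
  have hlo := hl.1
  have hval : ∀ {η ζ}, IsOrd η → ζ ∈ₛ l → (∀ c, c ∈ₛ η → ζ ≠ enum κ g c) →
      enum κ g η ∈ₛ l ∧ (∀ c, c ∈ₛ η → enum κ g η ≠ enum κ g c) := by
    intro η ζ hη hζ hζη
    obtain ⟨d, -, ⟨w, -, hw⟩, hn, -⟩ := enum_isNext hκ hlo hg hη hζ hζη
    exact ⟨(hg.1.mem hw).2, fun c hc e => hn ⟨c, app_lam.2 ⟨hc, e⟩⟩⟩
  have hinj : ∀ {η}, IsOrd η → (∀ c, c ∈ₛ η → ∃ ζ, ζ ∈ₛ l ∧ ∀ c', c' ∈ₛ c → ζ ≠ enum κ g c') →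
      ∀ c c', c ∈ₛ η → c' ∈ₛ η → enum κ g c = enum κ g c' → c = c' := by
    intro η hη hη' c c' hc hc' e
    obtain ⟨ζ, hζ, hζc⟩ := hη' c hc
    obtain ⟨ζ', hζ', hζc'⟩ := hη' c' hc'
    rcases (hη.mem hc).trichotomy (hη.mem hc') with h' | h' | h'
    · exact absurd e.symm ((hval (hη.mem hc') hζ' hζc').2 c h')
    · exact h'
    · exact absurd e ((hval (hη.mem hc) hζ hζc).2 c' h')
  by_cases hfull : ∀ ζ, ζ ∈ₛ l → ∃ c, c ∈ₛ κ ∧ ζ = enum κ g c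
  · -- the enumeration exhausts `l` at a stage `η ≤ κ`, so `l` is not a cardinal
    obtain ⟨η, hη, hηfull, hmin, hηκ⟩ := hκo.exists_least
      (P := fun η => ∀ ζ, ζ ∈ₛ l → ∃ c, c ∈ₛ η ∧ ζ = enum κ g c) hfull
    have hη' : ∀ c, c ∈ₛ η → ∃ ζ, ζ ∈ₛ l ∧ ∀ c', c' ∈ₛ c → ζ ≠ enum κ g c' := by
      intro c hc
      have := hmin c hc
      push Not at this
      exact this
    have hηl : η ∈ₛ l := by
      rcases mem_succ.1 hηκ with h' | rfl
      · exact hlo.mem_trans h' hκl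
      · exact hκl
    refine hl.2 η hηl ⟨lam η (enum κ g), isSurj_lam (fun c hc => ?_) hηfull, ?_⟩
    · obtain ⟨ζ, hζ, hζc⟩ := hη' c hc
      exact (hval (hη.mem hc) hζ hζc).1
    · intro c c' y hy hy'
      obtain ⟨hc, rfl⟩ := app_lam.1 hy
      obtain ⟨hc', e⟩ := app_lam.1 hy'
      exact hinj hη hη' c c' hc hc' e
  · -- otherwise the first `κ` values lie in the image of a single `V_d`
    push Not at hfull
    obtain ⟨ζ, hζ, hζκ⟩ := hfull
    obtain ⟨w, hw, hwζ⟩ := hg.2 ζ hζ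
    obtain ⟨b, hb, hwb⟩ := (mem_V hκo).1 hw
    have hζi : InImg g (succ b) ζ := ⟨w, (mem_V_succ (hκo.mem hb)).2 hwb, hwζ⟩
    have hbκ := hκ.succ_mem b hb
    have hκ' : ∀ c, c ∈ₛ κ → ∃ ζ, ζ ∈ₛ l ∧ ∀ c', c' ∈ₛ c → ζ ≠ enum κ g c' :=
      fun c hc => ⟨ζ, hζ, fun c' hc' => hζκ c' (hκo.mem_trans hc' hc)⟩
    have himg : ∀ η, η ∈ₛ κ → InImg g (succ b) (enum κ g η) := by
      intro η hη
      obtain ⟨d, hd, hi, -, h1, -⟩ := enum_isNext hκ hlo hg (hκo.mem hη) hζ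
        fun c hc => hζκ c (hκo.mem_trans hc hη)
      refine hi.mono (hκo.mem hd) (hκo.mem hbκ) ?_
      rw [← (hκo.mem hbκ).not_mem_iff (hκo.mem hd)]
      intro hbd
      obtain ⟨c, hc⟩ := h1 _ ζ hbd hζi
      obtain ⟨hc, e⟩ := app_lam.1 hc
      exact hζκ c (hκo.mem_trans hc hη) e
    refine h _ hbκ (exists_isSurj (fun w z => App g w (enum κ g z)) hκ.emp_mem ?_ himg)
    intro w z z' hw hz hz' e e'
    refine hinj hκo hκ' z z' hz hz' ?_
    rw [(hg.1.app_iff.1 e).2, (hg.1.app_iff.1 e').2]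

end ZFModel

/-! ### Hulls including `V_κ` -/

namespace ZFModel

variable {M : Type u} [setLang.Structure M]

/-- `z` lies in the range of `h`. -/
def Ran (h z : M) : Prop := ∃ w, App h w z

theorem IsFun.mono {f a b c : M} (hf : IsFun f a b) (h : b ⊆ₛ c) : IsFun f a c :=
  ⟨fun p hp => by
    obtain ⟨x, y, hx, hy, e⟩ := hf.1 p hp
    exact ⟨x, y, hx, h y hy, e⟩, hf.2⟩

variable [hZF : ZF M]

/-- `h` is a function from some `V_d` with `d < κ` to `V_b`: a small subset of `V_b` together with
an enumeration, so that unions of definable families of such sets can be enumerated without any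
choice. -/
def IsSmallFun (κ b h : M) : Prop := ∃ d, d ∈ₛ κ ∧ IsFun h (V d) (V b)

/-- The range of `h₂` includes the ranges of `h` and `h'`, and is closed under the operations of
`IsHull` as far as they are applied to elements of these two ranges. -/
def StepTo (h h' h₂ : M) : Prop :=
  ∀ u w, Ran h u ∨ Ran h' u → Ran h w ∨ Ran h' w →
    Ran h₂ u ∧ Ran h₂ (opair u w) ∧ (∀ a c, u = opair a c → Ran h₂ a ∧ Ran h₂ c) ∧
      ∀ z, App u w z → ∃ z', Ran h₂ z' ∧ App u w z'

section
variable {n : ℕ} {f g h : (Fin n → M) → M} [DefF f] [DefF g] [DefF h]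
instance : DefP fun v => Ran (f v) (g v) := by unfold Ran; infer_instance
instance : DefP fun v => IsSmallFun (f v) (g v) (h v) := by unfold IsSmallFun; infer_instance
instance : DefP fun v => StepTo (f v) (g v) (h v) := by unfold StepTo; infer_instance
end

theorem IsOrd.exists_upper {κ a b : M} (hκ : IsOrd κ) (ha : a ∈ₛ κ) (hb : b ∈ₛ κ) :
    ∃ c, c ∈ₛ κ ∧ a ⊆ₛ c ∧ b ⊆ₛ c := by
  rcases (hκ.mem ha).sub_total (hκ.mem hb) with h | h
  · exact ⟨b, hb, h, Sub.refl b⟩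
  · exact ⟨a, ha, Sub.refl a, h⟩

/-- Any two small functions are absorbed by a third one: enumerate the trace on `V_b` of a small hull
that contains both. -/
theorem IsWeaklyLS.exists_stepTo {κ b h h' d : M} (hκ : IsWeaklyLS κ) (hb : IsLim b)
    (hh : IsSmallFun κ b h) (hh' : IsSmallFun κ b h') (hd : d ∈ₛ κ) :
    ∃ h₂, IsSmallFun κ b h₂ ∧ (∀ z, z ∈ₛ V d → z ∈ₛ V b → Ran h₂ z) ∧ StepTo h h' h₂ := by
  have hκo := hκ.isOrd
  have ht := isTrans_V hb.isOrd
  obtain ⟨e, he, hf⟩ := hh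
  obtain ⟨e', he', hf'⟩ := hh'
  obtain ⟨c₁, hc₁, hec, hec'⟩ := hκo.exists_upper he he'
  obtain ⟨c₂, hc₂, hdc, homc⟩ := hκo.exists_upper hd hκ.om_mem
  obtain ⟨c, hc, h₁, h₂⟩ := hκo.exists_upper hc₁ hc₂
  have hV : ∀ {a}, a ∈ₛ κ → a ⊆ₛ c → V a ⊆ₛ V c := fun ha hac =>
    V_mono (hκo.mem ha) (hκo.mem hc) hac
  obtain ⟨Z, hZ, hcZ, hhZ, -, δ, f, hδ, hfZ⟩ := hκ.exists_isHull hc (opair h h')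
  have hran : ∀ u, Ran h u ∨ Ran h' u → u ∈ₛ Z ∧ u ∈ₛ V b := by
    rintro u (⟨w, hw⟩ | ⟨w, hw⟩)
    · obtain ⟨hwe, rfl⟩ := hf.app_iff.1 hw
      exact ⟨hZ.val_mem hf (hZ.fst_mem _ _ hhZ) hwe (hcZ _ (hV he (hec.trans h₁) _ hwe)),
        hf.val_mem hwe⟩
    · obtain ⟨hwe, rfl⟩ := hf'.app_iff.1 hw
      exact ⟨hZ.val_mem hf' (hZ.snd_mem _ _ hhZ) hwe (hcZ _ (hV he' (hec'.trans h₁) _ hwe)),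
        hf'.val_mem hwe⟩
  have hemp : emp M ∈ₛ sep Z fun z => z ∈ₛ V b := mem_sep.2
    ⟨hcZ _ (sub_V (hκo.mem hc) _ (h₂ _ (homc _ emp_mem_om))), sub_V hb.isOrd _ hb.emp_mem⟩
  obtain ⟨k, hk⟩ := exists_isSurj (D := V δ) (fun w z => App f w z) hemp
    (fun w z z' _ _ _ e e' => by rw [(hfZ.1.app_iff.1 e).2, (hfZ.1.app_iff.1 e').2])
    (fun z hz => hfZ.2 z (mem_sep.1 hz).1)
  have hkran : ∀ z, z ∈ₛ Z → z ∈ₛ V b → Ran k z := fun z hz hzb => by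
    obtain ⟨w, -, h⟩ := hk.2 z (mem_sep.2 ⟨hz, hzb⟩)
    exact ⟨w, h⟩
  refine ⟨k, ⟨δ, hδ, hk.1.mono fun z hz => (mem_sep.1 hz).2⟩,
    fun z hz hzb => hkran z (hcZ _ (hV hd (hdc.trans h₂) z hz)) hzb, fun u w hu hw => ?_⟩
  obtain ⟨hu, hub⟩ := hran u hu
  obtain ⟨hw, hwb⟩ := hran w hw
  refine ⟨hkran u hu hub, hkran _ (hZ.opair_mem u w hu hw) (hb.opair_mem hub hwb), ?_, ?_⟩
  · rintro a c rfl
    exact ⟨hkran a (hZ.fst_mem a c hu) (fst_mem_of_opair_mem ht hub),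
      hkran c (hZ.snd_mem a c hu) (snd_mem_of_opair_mem ht hub)⟩
  · intro z hz
    obtain ⟨z', hz', h'⟩ := hZ.app u w z hu hw hz
    exact ⟨z', hkran z' hz' (snd_mem_of_opair_mem ht (ht u hub _ (app_iff.1 h'))), h'⟩

/-- If `κ` is a singular weakly Löwenheim–Skolem cardinal, then every set lies in a hull that
includes `V_κ` and is a surjective image of it. The hull is the union of the ranges of the small
functions that lie in a suitable small hull `Y`, where `Y` meets `κ` in a cofinal set. -/
theorem IsWeaklyLS.exists_isHull_V {κ : M} (hκ : IsWeaklyLS κ) (hsing : IsSingular κ) (x : M) :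
    ∃ W, IsHull W ∧ V κ ⊆ₛ W ∧ x ∈ₛ W ∧ ∃ f, IsSurj f (V κ) W := by
  have hκo := hκ.isOrd
  obtain ⟨c, ⟨-, ⟨F, hF, hcof⟩, -⟩, hc⟩ := hsing
  obtain ⟨b, hb, hκb, hxb⟩ := exists_isLim_mem_V x hκo
  have hκVb : V κ ⊆ₛ V b := V_mono hκo hb.isOrd (hb.isOrd.sub hκb)
  let S := sep (pow (prod (V b) (V b))) fun h => IsSmallFun κ b h
  have hS : ∀ {h}, IsSmallFun κ b h → h ∈ₛ S := by
    rintro h ⟨d, hd, hh⟩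
    refine mem_sep.2 ⟨mem_pow.2 fun p hp => ?_, d, hd, hh⟩
    obtain ⟨y, z, hy, hz, e⟩ := hh.1 p hp
    exact mem_prod.2 ⟨y, z, hκVb y (V_mono (hκo.mem hd) hκo (hκo.sub hd) y hy), hz, isPair_iff.1 e⟩
  let R := sep (prod (prod S (prod S κ)) S) fun p => ∃ h h' d h₂,
    p = opair (opair h (opair h' d)) h₂ ∧ (∀ z, z ∈ₛ V d → z ∈ₛ V b → Ran h₂ z) ∧ StepTo h h' h₂
  have hR : ∀ {h h' d h₂}, App R (opair h (opair h' d)) h₂ → IsSmallFun κ b h₂ ∧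
      (∀ z, z ∈ₛ V d → z ∈ₛ V b → Ran h₂ z) ∧ StepTo h h' h₂ := by
    intro h h' d h₂ happ
    rw [app_iff, mem_sep, opair_mem_prod] at happ
    obtain ⟨⟨-, h₂S⟩, k, k', d', k₂, e, h1, h2⟩ := happ
    simp only [opair_inj] at e
    obtain ⟨⟨rfl, rfl, rfl⟩, rfl⟩ := e
    exact ⟨(mem_sep.1 h₂S).2, h1, h2⟩
  let h₀ := lam (V (om M)) fun _ => x
  have h₀small : IsSmallFun κ b h₀ := ⟨om M, hκ.om_mem, isFun_lam fun _ _ => hxb⟩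
  have h₀x : Ran h₀ x := ⟨emp M, app_lam.2 ⟨sub_V isOrd_om _ emp_mem_om, rfl⟩⟩
  obtain ⟨Y, hY, hcY, hpY, -, δ, f, hδ, hfY⟩ := hκ.exists_isHull hc (opair R (opair F h₀))
  have hRY := hY.fst_mem _ _ hpY
  have hFY := hY.fst_mem _ _ (hY.snd_mem _ _ hpY)
  have h₀Y := hY.snd_mem _ _ (hY.snd_mem _ _ hpY)
  have hcofY : ∀ β, β ∈ₛ κ → ∃ d, d ∈ₛ κ ∧ d ∈ₛ Y ∧ β ⊆ₛ d := by
    intro β hβ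
    obtain ⟨ξ, d, hξ, hd, hβd⟩ := hcof β hβ
    obtain ⟨-, rfl⟩ := hF.app_iff.1 hd
    exact ⟨_, hF.val_mem hξ, hY.val_mem hF hFY hξ (hcY _ (sub_V (hκo.mem hc) ξ hξ)), hβd⟩
  have key : ∀ {h h' d}, h ∈ₛ Y → h' ∈ₛ Y → d ∈ₛ Y → IsSmallFun κ b h → IsSmallFun κ b h' →
      d ∈ₛ κ → ∃ h₂, h₂ ∈ₛ Y ∧ IsSmallFun κ b h₂ ∧ (∀ z, z ∈ₛ V d → z ∈ₛ V b → Ran h₂ z) ∧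
        StepTo h h' h₂ := by
    intro h h' d hhY hhY' hdY hh hh' hd
    obtain ⟨h₂, hh₂, h1, h2⟩ := hκ.exists_stepTo hb hh hh' hd
    have : App R (opair h (opair h' d)) h₂ := app_iff.2 <| mem_sep.2
      ⟨opair_mem_prod.2 ⟨opair_mem_prod.2 ⟨hS hh, opair_mem_prod.2 ⟨hS hh', hd⟩⟩, hS hh₂⟩,
        h, h', d, h₂, rfl, h1, h2⟩
    obtain ⟨k, hk, hk'⟩ := hY.app _ _ _ hRY
      (hY.opair_mem _ _ hhY (hY.opair_mem _ _ hhY' hdY)) this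
    exact ⟨k, hk, hR hk'⟩
  let W := sep (V b) fun u => ∃ h, h ∈ₛ Y ∧ IsSmallFun κ b h ∧ Ran h u
  have hW : ∀ {u}, u ∈ₛ W ↔ ∃ h, h ∈ₛ Y ∧ IsSmallFun κ b h ∧ Ran h u := by
    intro u
    refine mem_sep.trans (and_iff_right_of_imp ?_)
    rintro ⟨h, -, ⟨d, -, hf⟩, w, hw⟩
    exact (hf.mem hw).2
  obtain ⟨d₀, hd₀, hd₀Y, -⟩ := hcofY _ hκ.isLim.emp_mem
  -- two elements of `W` and the sets obtained from them lie in the range of one function in `Y`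
  have step : ∀ {u w}, u ∈ₛ W → w ∈ₛ W → ∃ h₂, h₂ ∈ₛ Y ∧ IsSmallFun κ b h₂ ∧
      Ran h₂ (opair u w) ∧ (∀ a c, u = opair a c → Ran h₂ a ∧ Ran h₂ c) ∧
      ∀ z, App u w z → ∃ z', Ran h₂ z' ∧ App u w z' := by
    intro u w hu hw
    obtain ⟨h, hhY, hh, hhu⟩ := hW.1 hu
    obtain ⟨h', hhY', hh', hhw⟩ := hW.1 hw
    obtain ⟨h₂, hh₂, hs, -, hst⟩ := key hhY hhY' hd₀Y hh hh' hd₀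
    exact ⟨h₂, hh₂, hs, (hst u w (.inl hhu) (.inr hhw)).2⟩
  have hκW : V κ ⊆ₛ W := by
    intro z hz
    obtain ⟨β, hβ, hzβ⟩ := (mem_V hκo).1 hz
    obtain ⟨d, hd, hdY, hβd⟩ := hcofY _ (hκ.isLim.succ_mem β hβ)
    obtain ⟨h₂, hh₂, hs, hV, -⟩ := key h₀Y h₀Y hdY h₀small h₀small hd
    exact hW.2 ⟨h₂, hh₂, hs, hV z (V_mono (hκo.mem hβ).isOrd_succ (hκo.mem hd) hβd z
      ((mem_V_succ (hκo.mem hβ)).2 hzβ)) (hκVb z hz)⟩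
  refine ⟨W, ⟨?_, ?_, ?_, ?_⟩, hκW, hW.2 ⟨h₀, h₀Y, h₀small, h₀x⟩, ?_⟩
  · intro u w hu hw
    obtain ⟨h₂, hh₂, hs, h', -⟩ := step hu hw
    exact hW.2 ⟨h₂, hh₂, hs, h'⟩
  · intro u w hp
    obtain ⟨h₂, hh₂, hs, -, h', -⟩ := step hp hp
    exact hW.2 ⟨h₂, hh₂, hs, (h' u w rfl).1⟩
  · intro u w hp
    obtain ⟨h₂, hh₂, hs, -, h', -⟩ := step hp hp
    exact hW.2 ⟨h₂, hh₂, hs, (h' u w rfl).2⟩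
  · intro q u z hq hu hz
    obtain ⟨h₂, hh₂, hs, -, -, h'⟩ := step hq hu
    obtain ⟨z', hz', happ⟩ := h' z hz
    exact ⟨z', hW.2 ⟨h₂, hh₂, hs, hz'⟩, happ⟩
  · -- `⟨y, z⟩ ↦ f(y)(z)` maps `V_κ` onto `W`
    refine exists_isSurj (fun w u => ∃ y z h, w = opair y z ∧ App f y h ∧ IsSmallFun κ b h ∧
      App h z u) (hW.2 ⟨h₀, h₀Y, h₀small, h₀x⟩) ?_ ?_
    · rintro w u u' - - - ⟨y, z, h, rfl, hy, ⟨d, -, hh⟩, hu⟩ ⟨y', z', h', e, hy', -, hu'⟩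
      obtain ⟨rfl, rfl⟩ := opair_inj.1 e
      obtain rfl : h = h' := by rw [(hfY.1.app_iff.1 hy).2, (hfY.1.app_iff.1 hy').2]
      rw [(hh.app_iff.1 hu).2, (hh.app_iff.1 hu').2]
    · intro u hu
      obtain ⟨h, hhY, hh, z, hz⟩ := hW.1 hu
      obtain ⟨y, hy, hyh⟩ := hfY.2 h hhY
      obtain ⟨d, hd, hf⟩ := id hh
      have hV : ∀ {a}, a ∈ₛ κ → V a ⊆ₛ V κ := fun ha => V_mono (hκo.mem ha) hκo (hκo.sub ha)
      exact ⟨opair y z, hκ.isLim.opair_mem (hV hδ y hy) (hV hd z (hf.mem hz).1),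
        y, z, h, rfl, hyh, hh, hz⟩

/-! ### The elementary submodel -/

/-- Every nonempty ordinal below `κ⁺` is a surjective image of `κ`. -/
theorem IsSuccCard.exists_isSurj {κ l ξ η : M} (hκ : IsOrd κ) (hl : IsSuccCard l κ) (hξ : ξ ∈ₛ l)
    (hη : η ∈ₛ ξ) : ∃ f, IsSurj f κ ξ := by
  have hlo := hl.1.1
  have hξo := hlo.mem hξ
  have hid : ∃ f, IsBij f ξ ξ := by
    refine ⟨lam ξ fun w => w, isSurj_lam (fun _ h => h) fun y hy => ⟨y, hy, rfl⟩, ?_⟩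
    intro w w' y hw hw'
    rw [← (app_lam.1 hw).2, (app_lam.1 hw').2]
  obtain ⟨μ, hμ, ⟨f, hf⟩, hmin, hμξ⟩ := hξo.exists_least (P := fun μ => ∃ f, IsBij f μ ξ) hid
  have hcard : IsCard μ := by
    refine ⟨hμ, fun g hg => ?_⟩
    rintro ⟨k, hk⟩
    refine hmin g hg ⟨lam g fun w => val f (val k w), isSurj_lam (fun w hw => ?_) fun y hy => ?_, ?_⟩
    · exact hf.1.1.val_mem (hk.1.1.val_mem hw)
    · obtain ⟨v, hv, rfl⟩ := hf.1.exists_val hy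
      obtain ⟨w, hw, rfl⟩ := hk.1.exists_val hv
      exact ⟨w, hw, rfl⟩
    · intro w w' y hwy hwy'
      obtain ⟨hw, rfl⟩ := app_lam.1 hwy
      obtain ⟨hw', e⟩ := app_lam.1 hwy'
      have e' := hf.2 _ _ _ (hf.1.1.app_val (hk.1.1.val_mem hw))
        (e ▸ hf.1.1.app_val (hk.1.1.val_mem hw'))
      exact hk.2 _ _ _ (hk.1.1.app_val hw) (e' ▸ hk.1.1.app_val hw')
  have hμκ : μ ⊆ₛ κ := by
    rw [← hκ.not_mem_iff hμ]
    intro h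
    have h1 := hl.2.2 μ hcard h ξ hξ
    rcases mem_succ.1 hμξ with h2 | rfl
    · exact mem_asymm h1 h2
    · exact mem_irrefl _ h1
  exact ZFModel.exists_isSurj (fun w z => App f w z) hη
    (fun w z z' _ _ _ e e' => by rw [(hf.1.1.app_iff.1 e).2, (hf.1.1.app_iff.1 e').2])
    (fun z hz => let ⟨w, hw, h⟩ := hf.1.2 z hz; ⟨w, hμκ w hw, h⟩)

/-- The instances of the Tarski-Vaught criterion for `A`: `⟨⟨⟨i, a⟩, t⟩, y⟩` lies in this set if
`A ⊨ a[t[i := y]]`. -/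
noncomputable def witnesses (T A : M) : M :=
  sep (prod (prod (prod (om M) (forms M)) (asg A)) A) fun p =>
    ∃ i a t y, p = opair (opair (opair i a) t) y ∧ App T a (upd t i y)

/-- The graph of the function `⟨t, ⟨i, y⟩⟩ ↦ t[i := y]` on assignments in `A`. -/
noncomputable def updates (A : M) : M :=
  sep (prod (prod (asg A) (prod (om M) A)) (asg A)) fun p =>
    ∃ t i y, p = opair (opair t (opair i y)) (upd t i y)

/-- The relation between the elements `ξ` of `l` and the surjections from `κ` onto `ξ`. -/
noncomputable def surjections (κ l : M) : M :=
  sep (prod l (pow (prod κ l))) fun p => ∃ ξ f, p = opair ξ f ∧ IsSurj f κ ξ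

theorem app_witnesses {T A i a t y : M} : App (witnesses T A) (opair (opair i a) t) y ↔
    i ∈ₛ om M ∧ IsForm a ∧ IsFun t (om M) A ∧ y ∈ₛ A ∧ App T a (upd t i y) := by
  rw [app_iff, witnesses, mem_sep]
  simp only [opair_mem_prod, mem_forms, mem_asg]
  constructor
  · rintro ⟨⟨⟨⟨hi, ha⟩, ht⟩, hy⟩, i', a', t', y', e, h⟩
    simp only [opair_inj] at e
    obtain ⟨⟨⟨rfl, rfl⟩, rfl⟩, rfl⟩ := e
    exact ⟨hi, ha, ht, hy, h⟩
  · rintro ⟨hi, ha, ht, hy, h⟩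
    exact ⟨⟨⟨⟨hi, ha⟩, ht⟩, hy⟩, i, a, t, y, rfl, h⟩

theorem app_updates {A t i y t' : M} : App (updates A) (opair t (opair i y)) t' ↔
    IsFun t (om M) A ∧ i ∈ₛ om M ∧ y ∈ₛ A ∧ t' = upd t i y := by
  rw [app_iff, updates, mem_sep]
  simp only [opair_mem_prod, mem_asg]
  constructor
  · rintro ⟨⟨⟨ht, hi, hy⟩, ht'⟩, u, i', y', e⟩
    simp only [opair_inj] at e
    obtain ⟨⟨rfl, rfl, rfl⟩, rfl⟩ := e
    exact ⟨ht, hi, hy, rfl⟩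
  · rintro ⟨ht, hi, hy, rfl⟩
    exact ⟨⟨⟨ht, hi, hy⟩, ht.upd hy⟩, t, i, y, rfl⟩

theorem app_surjections {κ l ξ f : M} (hl : IsOrd l) :
    App (surjections κ l) ξ f ↔ ξ ∈ₛ l ∧ IsSurj f κ ξ := by
  rw [app_iff, surjections, mem_sep, opair_mem_prod]
  constructor
  · rintro ⟨⟨hξ, -⟩, ξ', f', e, h⟩
    obtain ⟨rfl, rfl⟩ := opair_inj.1 e
    exact ⟨hξ, h⟩
  · rintro ⟨hξ, h⟩
    exact ⟨⟨hξ, (h.1.mono (hl.sub hξ)).mem_prod_pow⟩, ξ, f, rfl, h⟩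

/-- A hull that contains a constant assignment and the sets `witnesses T A` and `updates A` meets
`A` in an elementary submodel. -/
theorem IsHull.isElemSub {W T A x : M} (hW : IsHull W) (hom : V (om M) ⊆ₛ W) (hT : Tarski T A)
    (hx : x ∈ₛ A) (hxW : x ∈ₛ W) (hTW : witnesses T A ∈ₛ W) (hUW : updates A ∈ₛ W)
    (hcW : (lam (om M) fun _ => x) ∈ₛ W) : IsElemSub (sep W fun z => z ∈ₛ A) A := by
  refine isElemSub_of hT ⟨x, mem_sep.2 ⟨hxW, hx⟩⟩ (fun z hz => (mem_sep.1 hz).2) ?_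
  rintro s i a hs hi ha ⟨y, hy, hay⟩
  have hsA : IsFun s (om M) A := hs.mono fun z hz => (mem_sep.1 hz).2
  have homW : ∀ {n}, n ∈ₛ om M → n ∈ₛ W := fun hn => hom _ (sub_V isOrd_om _ hn)
  -- the hull contains assignments that agree with `s` up to any given natural number
  have approx : ∀ n, n ∈ₛ om M → ∃ t, t ∈ₛ W ∧ IsFun t (om M) A ∧
      ∀ j, j ∈ₛ n → val t j = val s j := by
    intro n hn
    refine om_induction (P := fun n => ∃ t, t ∈ₛ W ∧ IsFun t (om M) A ∧
      ∀ j, j ∈ₛ n → val t j = val s j) ?_ ?_ hn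
    · exact ⟨_, hcW, isFun_lam fun _ _ => hx, fun j hj => absurd hj not_mem_emp⟩
    · rintro n hn ⟨t, htW, ht, hts⟩
      obtain ⟨hsW, hsA'⟩ := mem_sep.1 (hs.val_mem hn)
      obtain ⟨t', ht'W, ht'⟩ := hW.app _ _ _ hUW
        (hW.opair_mem _ _ htW (hW.opair_mem _ _ (homW hn) hsW))
        (app_updates.2 ⟨ht, hn, hsA', rfl⟩)
      obtain ⟨-, -, -, rfl⟩ := app_updates.1 ht'
      refine ⟨_, ht'W, ht.upd hsA', fun j hj => ?_⟩
      by_cases hjn : j = n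
      · subst hjn
        rw [val_upd_self hn]
      · have hjn' : j ∈ₛ n := (mem_succ.1 hj).resolve_right hjn
        rw [val_upd_ne (isOrd_om.mem_trans hjn' hn) hjn, hts j hjn']
  obtain ⟨n, hn, hsupp⟩ := hT.exists_support ha
  obtain ⟨t, htW, ht, hts⟩ := approx n hn
  have hiff : ∀ y, y ∈ₛ A → (App T a (upd t i y) ↔ App T a (upd s i y)) := by
    intro y hy
    refine hsupp _ _ (ht.upd hy) (hsA.upd hy) fun j hj => ?_
    have hjo := isOrd_om.mem_trans hj hn
    by_cases hji : j = i
    · subst hji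
      rw [val_upd_self hjo, val_upd_self hjo]
    · rw [val_upd_ne hjo hji, val_upd_ne hjo hji, hts j hj]
  obtain ⟨y', hy'W, hy'⟩ := hW.app _ _ _ hTW
    (hW.opair_mem _ _ (hW.opair_mem _ _ (homW hi) (hom _ ha.mem_V_om)) htW)
    (app_witnesses.2 ⟨hi, ha, ht, hy, (hiff y hy).2 hay⟩)
  obtain ⟨-, -, -, hy'A, h'⟩ := app_witnesses.1 hy'
  exact ⟨y', mem_sep.2 ⟨hy'W, hy'A⟩, (hiff y' hy'A).1 h'⟩

/-- Cantor's argument: a set that includes `V_κ`, for a limit `κ`, is not a surjective image of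
`V_d` for any `d < κ`. -/
theorem IsLim.not_isSurj_of_V_sub {κ d W f : M} (hκ : IsLim κ) (hd : d ∈ₛ κ) (hW : V κ ⊆ₛ W) :
    ¬ IsSurj f (V d) W := by
  intro hf
  have hdo := hκ.isOrd.mem hd
  have hD : (sep (V d) fun z => ¬ z ∈ₛ val f z) ∈ₛ V κ :=
    (mem_V hκ.isOrd).2 ⟨d, hd, fun z hz => (mem_sep.1 hz).1⟩
  obtain ⟨w, hw, e⟩ := hf.exists_val (hW _ hD)
  have : w ∈ₛ val f w ↔ w ∈ₛ V d ∧ ¬ w ∈ₛ val f w := by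
    conv_lhs => rw [← e]
    exact mem_sep
  tauto

end ZFModel

theorem lemma1 {M : Type u} [setLang.Structure M] (hM : IsModelOfZF M)
    (κ : M) (hκ : IsWeaklyLS κ) (hsing : IsSingular κ)
    (κ' : M) (hκ' : IsSuccCard κ' κ)
    (α : M) (hα : IsOrd α) (hκα : κ' ⊆ₛ α)
    (Vκ Vα : M) (hVκ : IsV Vκ κ) (hVα : IsV Vα α)
    (x : M) (hx : x ∈ₛ Vα) :
    ∃ X : M, IsElemSub X Vα ∧ x ∈ₛ X ∧ Vκ ⊆ₛ X ∧
      (∃ δ, δ ∈ₛ κ' ∧ ∀ z, z ∈ₛ δ ↔ z ∈ₛ X ∧ z ∈ₛ κ') ∧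
      IsNorm κ X := by
  have : ZF M := ⟨hM⟩
  obtain ⟨hκo, rfl⟩ := isV_iff.1 hVκ
  obtain ⟨-, rfl⟩ := isV_iff.1 hVα
  have hκ'o := hκ'.1.1
  have hκα' : κ ∈ₛ α := hκα κ hκ'.2.1
  have hκVα : V κ ⊆ₛ V α := V_mono hκo hα (hα.sub hκα')
  obtain ⟨T, hT⟩ := exists_tarski (V α)
  obtain ⟨W, hW, hκW, hpW, f, hf⟩ := hκ.exists_isHull_V hsing (opair x (opair (witnesses T (V α))
    (opair (updates (V α)) (opair (lam (om M) fun _ => x) (surjections κ κ')))))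
  have hxW := hW.fst_mem _ _ hpW
  replace hpW := hW.snd_mem _ _ hpW
  have hTW := hW.fst_mem _ _ hpW
  replace hpW := hW.snd_mem _ _ hpW
  have hUW := hW.fst_mem _ _ hpW
  replace hpW := hW.snd_mem _ _ hpW
  have hcW := hW.fst_mem _ _ hpW
  have hsW := hW.snd_mem _ _ hpW
  have homW : V (om M) ⊆ₛ W := (V_mono isOrd_om hκo (hκo.sub hκ.om_mem)).trans hκW
  have hκX : V κ ⊆ₛ sep W fun z => z ∈ₛ V α := fun z hz => mem_sep.2 ⟨hκW z hz, hκVα z hz⟩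
  have hxX : x ∈ₛ sep W fun z => z ∈ₛ V α := mem_sep.2 ⟨hxW, hx⟩
  have hfun : ∀ w z z', App f w z → App f w z' → z = z' := fun w z z' e e' => by
    rw [(hf.1.app_iff.1 e).2, (hf.1.app_iff.1 e').2]
  refine ⟨sep W fun z => z ∈ₛ V α, hW.isElemSub homW hT hx hxW hTW hUW hcW, hxX, hκX, ?_, ?_⟩
  · -- `X ∩ κ⁺` is transitive, since `X` contains a surjection from `κ` onto each of its elements
    have ho : IsOrd (sep κ' fun z => z ∈ₛ W) := by
      refine ⟨fun ξ hξ η hη => ?_, fun ξ hξ => (hκ'o.mem (mem_sep.1 hξ).1).1⟩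
      obtain ⟨hξ, hξW⟩ := mem_sep.1 hξ
      obtain ⟨k, hk⟩ := hκ'.exists_isSurj hκo hξ hη
      obtain ⟨k', hk'W, hk'⟩ := hW.app _ _ _ hsW hξW ((app_surjections hκ'o).2 ⟨hξ, hk⟩)
      have hk' := ((app_surjections hκ'o).1 hk').2
      obtain ⟨ζ, hζ, rfl⟩ := hk'.exists_val hη
      exact mem_sep.2 ⟨hκ'o.mem_trans hη hξ, hW.val_mem hk'.1 hk'W hζ (hκW _ (sub_V hκo ζ hζ))⟩
    refine ⟨sep κ' fun z => z ∈ₛ W, ?_, fun z => ?_⟩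
    · rcases ho.eq_or_mem_of_sub hκ'o (fun z hz => (mem_sep.1 hz).1) with h | h
      · exfalso
        have hsub : κ' ⊆ₛ W := fun z hz => (mem_sep.1 (by rwa [h] : z ∈ₛ sep κ' fun z => z ∈ₛ W)).2
        exact not_isSurj_of_card hκ.isLim (fun d hd => hκ.not_isSurj hd) hκ'.1 hκ'.2.1
          (exists_isSurj (fun w z => App f w z) hκ'.2.1 (fun w z z' _ _ _ => hfun w z z')
            fun z hz => hf.2 z (hsub z hz))
      · exact h
    · simp only [mem_sep]
      exact ⟨fun h => ⟨⟨h.2, sub_V hα z (hκα z h.1)⟩, h.1⟩, fun h => ⟨h.2, h.1.1⟩⟩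
  · refine ⟨?_, ?_⟩
    · obtain ⟨k, hk⟩ := exists_isSurj (D := V κ) (fun w z => App f w z) hxX
        (fun w z z' _ _ _ => hfun w z z') fun z hz => hf.2 z (mem_sep.1 hz).1
      exact ⟨_, k, isV_iff.2 ⟨hκo, rfl⟩, hk⟩
    · rintro m hm ⟨v, k, hv, hk⟩
      obtain ⟨-, rfl⟩ := isV_iff.1 hv
      exact hκ.isLim.not_isSurj_of_V_sub hm hκX hk
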